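/- Let $(M,g)$ be a compact smooth two-dimensional Riemannian manifold without boundary, and let $f:M\to\mathbb{R}$ be a Morse function, i.e. a smooth function whose Hessian is nondegenerate at every critical point. A gradient flow line is a curve $\gamma:\mathbb{R}\to M$ with $\gamma'(t)=-\nabla f(\gamma(t))$ for all $t$; let $\varphi(t,y)$ denote the point at time $t$ of the gradient flow line that is at $y$ at time $0$. For a critical point $p$ of $f$ put $$W^s(p)=\{y\in M:\lim_{t\to\infty}\varphi(t,y)=p\},\qquad W^u(p)=\{y\in M:\lim_{t\to-\infty}\varphi(t,y)=p\}.$$ The function $f$ is called Morse–Smale if it is Morse and, for all critical points $p,q$ of $f$, the submanifolds $W^s(q)$ and $W^u(p)$ intersect transversally, i.e. $T_xM=T_xW^s(q)+T_xW^u(p)$ for every $x\in W^s(q)\cap W^u(p)$. A saddle point is a critical point that is not a local extremum, and a Neumann line is a nonconstant gradient flow line contained in $W^s(r)$ or in $W^u(r)$ for some saddle point $r$. Then $f$ is Morse–Smale if and only if there is no Neumann line connecting two saddle points, i.e. no Neumann line $\gamma$ and distinct saddle points $q,p$ with $\lim_{t\to-\infty}\gamma(t)=q$ and $\lim_{t\to\infty}\gamma(t)=p$.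 -/

import Mathlib

open Set Filter Topology
open scoped Manifold ContDiff

noncomputable section

namespace GradientFlow

variable {n : ℕ} {M : Type*} [TopologicalSpace M] [ChartedSpace (EuclideanSpace ℝ (Fin n)) M]

/-- A smooth Riemannian metric on a smooth `n`-dimensional manifold without boundary. -/
abbrev Metric (n : ℕ) (M : Type*) [TopologicalSpace M]
    [ChartedSpace (EuclideanSpace ℝ (Fin n)) M] [IsManifold (𝓡 n) ∞ M] :=
  Bundle.ContMDiffRiemannianMetric (𝓡 n) ∞ (EuclideanSpace ℝ (Fin n))
    (fun x : M => TangentSpace (𝓡 n) x)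

/-- The scalar product on the tangent space at `x`, as a bilinear form. -/
def Metric.form [IsManifold (𝓡 n) ∞ M] (g : Metric n M) (x : M) :
    LinearMap.BilinForm ℝ (TangentSpace (𝓡 n) x) :=
  LinearMap.mk₂ ℝ (fun v w => g.inner x v w)
    (by intros; simp) (by intros; simp) (by intros; simp) (by intros; simp)

theorem Metric.form_nondegenerate [IsManifold (𝓡 n) ∞ M] (g : Metric n M) (x : M) :
    (g.form x).Nondegenerate := by
  constructor
  · intro v hv
    by_contra h
    exact (g.pos x v h).ne' (hv v)
  · intro v hv
    by_contra h
    exact (g.pos x v h).ne' (hv v)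

instance (x : M) : FiniteDimensional ℝ (TangentSpace (𝓡 n) x) :=
  inferInstanceAs (FiniteDimensional ℝ (EuclideanSpace ℝ (Fin n)))

/-- The differential of a real function at `x`, as a linear form on the tangent space. -/
def differential (f : M → ℝ) (x : M) : Module.Dual ℝ (TangentSpace (𝓡 n) x) :=
  (mfderiv (𝓡 n) 𝓘(ℝ, ℝ) f x).toLinearMap

/-- The Riemannian gradient: the vector `∇f(x)` with `g(∇f(x), w) = df(x) w` for all `w`. -/
def grad [IsManifold (𝓡 n) ∞ M] (g : Metric n M) (f : M → ℝ) (x : M) : TangentSpace (𝓡 n) x :=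
  ((g.form x).toDual (g.form_nondegenerate x)).symm (differential f x)

/-- `x` is a critical point of `f`. -/
def IsCriticalPoint (f : M → ℝ) (x : M) : Prop :=
  mfderiv (𝓡 n) 𝓘(ℝ, ℝ) f x = 0

/-- The Hessian matrix of `f` at `p` in the preferred chart around `p`. At a critical point its
nondegeneracy does not depend on the chart (nor on a metric). -/
def hessian (f : M → ℝ) (p : M) : Matrix (Fin n) (Fin n) ℝ :=
  Matrix.of fun i j =>
    fderiv ℝ (fderiv ℝ (f ∘ (extChartAt (𝓡 n) p).symm)) (extChartAt (𝓡 n) p p)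
      (EuclideanSpace.single i 1) (EuclideanSpace.single j 1)

variable (n) in
/-- A Morse function: smooth, with nondegenerate Hessian at every critical point. -/
structure IsMorse (f : M → ℝ) : Prop where
  smooth : ContMDiff (𝓡 n) 𝓘(ℝ, ℝ) ∞ f
  nondegenerate : ∀ p : M, IsCriticalPoint (n := n) f p → (hessian (n := n) f p).det ≠ 0

variable (n) in
/-- A saddle point: a critical point that is neither a local minimum nor a local maximum. -/
def IsSaddle (f : M → ℝ) (p : M) : Prop :=
  IsCriticalPoint (n := n) f p ∧ ¬ IsLocalExtr f p

/-- A (complete, parametrized) gradient flow line: a solution `γ : ℝ → M` of `γ' = -∇f(γ)`. -/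
def IsFlowLine [IsManifold (𝓡 n) ∞ M] (g : Metric n M) (f : M → ℝ) (γ : ℝ → M) : Prop :=
  IsMIntegralCurve (I := 𝓡 n) γ (fun x => -grad g f x)

/-- The stable manifold of `p`: the points whose flow line tends to `p` as `t → ∞`. -/
def stable [IsManifold (𝓡 n) ∞ M] (g : Metric n M) (f : M → ℝ) (p : M) : Set M :=
  {y | ∃ γ : ℝ → M, IsFlowLine g f γ ∧ γ 0 = y ∧ Tendsto γ atTop (𝓝 p)}

/-- The unstable manifold of `p`: the points whose flow line tends to `p` as `t → -∞`. -/
def unstable [IsManifold (𝓡 n) ∞ M] (g : Metric n M) (f : M → ℝ) (p : M) : Set M :=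
  {y | ∃ γ : ℝ → M, IsFlowLine g f γ ∧ γ 0 = y ∧ Tendsto γ atBot (𝓝 p)}

/-- The tangent space at `x` of a submanifold `S`, inside the tangent space of the ambient
manifold: it is spanned by the velocities at time `0` of the curves in `S` that pass through `x` at
time `0` and are differentiable there. (For an embedded submanifold `S`, locally the zero set of a
submersion, every such velocity lies in the usual tangent space of `S`, and all of the usual
tangent space is obtained.) -/
def tangentOf (S : Set M) (x : M) : Submodule ℝ (TangentSpace (𝓡 n) x) :=
  Submodule.span ℝ {v | ∃ γ : ℝ → M, γ 0 = x ∧ (∀ᶠ t in 𝓝 (0 : ℝ), γ t ∈ S) ∧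
    HasMFDerivAt 𝓘(ℝ, ℝ) (𝓡 n) γ 0 ((1 : ℝ →L[ℝ] ℝ).smulRight v)}

variable (n) in
/-- Transversality: at each common point, the two tangent spaces together span the tangent space
of the ambient manifold. -/
def Transversal (S T : Set M) : Prop :=
  ∀ x ∈ S ∩ T, tangentOf (n := n) S x ⊔ tangentOf (n := n) T x = ⊤

/-- A Morse–Smale function: a Morse function such that, for all critical points `p`, `q`, the
stable manifold of `q` and the unstable manifold of `p` are transversal. -/
def IsMorseSmale [IsManifold (𝓡 n) ∞ M] (g : Metric n M) (f : M → ℝ) : Prop :=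
  IsMorse n f ∧ ∀ p q : M, IsCriticalPoint (n := n) f p → IsCriticalPoint (n := n) f q →
    Transversal n (stable g f q) (unstable g f p)

/-- A Neumann line: a nonconstant gradient flow line contained in the stable or in the unstable
manifold of a saddle point. -/
def IsNeumannLine [IsManifold (𝓡 n) ∞ M] (g : Metric n M) (f : M → ℝ) (γ : ℝ → M) : Prop :=
  IsFlowLine g f γ ∧ ∃ r : M, IsSaddle n f r ∧
    ((∀ t, γ t ∈ stable g f r \ {r}) ∨ (∀ t, γ t ∈ unstable g f r \ {r}))

/-- The line `γ` connects `q` to `p`: it begins at `q` and ends at `p`. -/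
def Connects (γ : ℝ → M) (q p : M) : Prop :=
  Tendsto γ atBot (𝓝 q) ∧ Tendsto γ atTop (𝓝 p)

end GradientFlow

end
/-!
Reversing time turns `W^u` for `f` into `W^s` for `-f`, so only stable manifolds need study. The
stable manifold of a local minimum is open and no nonconstant orbit ends at a local maximum, so
transversality can only fail for `W^s(q)` and `W^u(p)` with `p` and `q` saddles.

Let `x` be a regular point of `W^s(p)` with `p` a saddle, and let `(a, b)` be eigencoordinates of
the linearization at `p`, with `a` contracting. On the difference of two orbits that stay near `p`
the form `b² - a²` would grow exponentially if it were ever positive, so such orbits agree as soon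
as their `a` agree; and since `a` tends to `0` along each, two of them on the same side take a
common value of `a`. Hence `W^s(p)` is near `x` a single orbit, tangent to `∇f(x)`. The same holds
for `W^u`, so along an orbit from saddle to saddle both tangent spaces lie on one line of the
plane `T_x M`. Conversely, a nontransverse regular intersection lies on such an orbit, and its
ends differ since `f` decreases along it.

At the saddle itself a Ważewski shooting argument in thin cones `|b| ≤ ε a` produces a curve in
`W^s(p)` tangent to the contracting eigenvector. With its counterpart in `W^u(p)` the eigenvectors
span `T_p M`, so the intersection at `p` is always transverse.
-/

noncomputable section

namespace GradientFlow

theorem contDiffAt_clm_of_apply {D E F : Type*} [NormedAddCommGroup D] [NormedSpace ℝ D]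
    [NormedAddCommGroup E] [NormedSpace ℝ E] [NormedAddCommGroup F] [NormedSpace ℝ F]
    [FiniteDimensional ℝ E] {k : ℕ∞ω} {f : D → E →L[ℝ] F} {x : D}
    (h : ∀ y, ContDiffAt ℝ k (fun x => f x y) x) : ContDiffAt ℝ k f x := by
  let b := Module.finBasis ℝ E
  have hsum : f = fun x => ∑ i, (b.coord i).toContinuousLinearMap.smulRight (f x (b i)) := by
    ext x y
    conv_lhs => rw [← b.sum_repr y, map_sum]
    simp
  rw [hsum]
  refine ContDiffAt.sum fun i _ => ?_
  let L := ContinuousLinearMap.smulRightL ℝ E F (b.coord i).toContinuousLinearMap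
  exact L.contDiff.contDiffAt.comp x (h (b i))

theorem isInvertible_of_pos {E : Type*} [NormedAddCommGroup E] [NormedSpace ℝ E]
    [FiniteDimensional ℝ E] {B : E →L[ℝ] E →L[ℝ] ℝ} (hB : ∀ a, a ≠ 0 → 0 < B a a) :
    B.IsInvertible := by
  have hinj : Function.Injective B := (injective_iff_map_eq_zero B).2 fun a ha => by
    by_contra hne
    simpa [ha] using hB a hne
  have hfr : Module.finrank ℝ E = Module.finrank ℝ (E →L[ℝ] ℝ) :=
    Subspace.dual_finrank_eq.symm.trans (LinearMap.toContinuousLinearMap).finrank_eq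
  exact ⟨(LinearMap.linearEquivOfInjective B.toLinearMap hinj hfr).toContinuousLinearEquiv, rfl⟩

section ChartCalculus

variable {n : ℕ} {M : Type*} [TopologicalSpace M] [ChartedSpace (EuclideanSpace ℝ (Fin n)) M]

theorem hasMFDerivAt_curve_iff {γ : ℝ → M} {t : ℝ} {v : EuclideanSpace ℝ (Fin n)} :
    HasMFDerivAt 𝓘(ℝ, ℝ) (𝓡 n) γ t ((1 : ℝ →L[ℝ] ℝ).smulRight v) ↔
      ContinuousAt γ t ∧ HasDerivAt (extChartAt (𝓡 n) (γ t) ∘ γ) v t := by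
  refine and_congr_right fun _ => ?_
  rw [ModelWithCorners.range_eq_univ]
  exact hasFDerivWithinAt_univ

theorem contDiffAt_comp_extChartAt_symm {F : Type*} [NormedAddCommGroup F] [NormedSpace ℝ F]
    {k : ℕ∞ω} [IsManifold (𝓡 n) k M] {f : M → F} {x : M}
    (hf : ContMDiffAt (𝓡 n) 𝓘(ℝ, F) k f x) :
    ContDiffAt ℝ k (f ∘ (extChartAt (𝓡 n) x).symm) (extChartAt (𝓡 n) x x) := by
  rw [contMDiffAt_iff_source_of_mem_source (x' := x) (mem_chart_source _ x)] at hf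
  simpa only [mfld_simps, contMDiffWithinAt_univ, contMDiffAt_iff_contDiffAt] using hf

variable [IsManifold (𝓡 n) 1 M]

theorem hasFDerivAt_coordChange {x y z : M}
    (hx : z ∈ (extChartAt (𝓡 n) x).source) (hy : z ∈ (extChartAt (𝓡 n) y).source) :
    HasFDerivAt (extChartAt (𝓡 n) y ∘ (extChartAt (𝓡 n) x).symm)
      (tangentCoordChange (𝓡 n) x y z) (extChartAt (𝓡 n) x z) := by
  simpa using hasFDerivWithinAt_tangentCoordChange (I := 𝓡 n) ⟨hx, hy⟩

theorem coordChange_coordChange {x y z : M} (hx : z ∈ (extChartAt (𝓡 n) x).source)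
    (hy : z ∈ (extChartAt (𝓡 n) y).source) (v : EuclideanSpace ℝ (Fin n)) :
    tangentCoordChange (𝓡 n) y x z (tangentCoordChange (𝓡 n) x y z v) = v := by
  rw [tangentCoordChange_comp ⟨⟨hx, hy⟩, hx⟩, tangentCoordChange_self hx]

theorem hasDerivAt_chart_of_hasMFDerivAt {γ : ℝ → M} {t : ℝ} {v : EuclideanSpace ℝ (Fin n)}
    (h : HasMFDerivAt 𝓘(ℝ, ℝ) (𝓡 n) γ t ((1 : ℝ →L[ℝ] ℝ).smulRight v)) {x : M}
    (hx : γ t ∈ (extChartAt (𝓡 n) x).source) :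
    HasDerivAt (extChartAt (𝓡 n) x ∘ γ) (tangentCoordChange (𝓡 n) (γ t) x (γ t) v) t := by
  obtain ⟨hc, hd⟩ := hasMFDerivAt_curve_iff.1 h
  refine ((hasFDerivAt_coordChange (mem_extChartAt_source (I := 𝓡 n) (γ t)) hx).comp_hasDerivAt t
    hd).congr_of_eventuallyEq ?_
  filter_upwards [hc.preimage_mem_nhds (extChartAt_source_mem_nhds (I := 𝓡 n) (γ t))] with s hs
  exact congrArg (extChartAt (𝓡 n) x) ((extChartAt (𝓡 n) (γ t)).left_inv hs).symm

theorem hasMFDerivAt_of_hasDerivAt_chart {γ : ℝ → M} {t : ℝ} {w : EuclideanSpace ℝ (Fin n)} {x : M}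
    (hc : ContinuousAt γ t) (hx : γ t ∈ (extChartAt (𝓡 n) x).source)
    (h : HasDerivAt (extChartAt (𝓡 n) x ∘ γ) w t) :
    HasMFDerivAt 𝓘(ℝ, ℝ) (𝓡 n) γ t
      ((1 : ℝ →L[ℝ] ℝ).smulRight (tangentCoordChange (𝓡 n) x (γ t) (γ t) w)) := by
  refine hasMFDerivAt_curve_iff.2 ⟨hc, ((hasFDerivAt_coordChange hx
    (mem_extChartAt_source (I := 𝓡 n) (γ t))).comp_hasDerivAt t h).congr_of_eventuallyEq ?_⟩
  filter_upwards [hc.preimage_mem_nhds (extChartAt_source_mem_nhds' hx)] with s hs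
  exact congrArg (extChartAt (𝓡 n) (γ t)) ((extChartAt (𝓡 n) x).left_inv hs).symm

/-- The vector field `v` on `M`, read in the preferred chart around `x`. -/
def chartRep (v : (y : M) → TangentSpace (𝓡 n) y) (x : M) (z : EuclideanSpace ℝ (Fin n)) :
    EuclideanSpace ℝ (Fin n) :=
  tangentCoordChange (𝓡 n) ((extChartAt (𝓡 n) x).symm z) x ((extChartAt (𝓡 n) x).symm z)
    (v ((extChartAt (𝓡 n) x).symm z))

theorem chartRep_extChartAt (v : (y : M) → TangentSpace (𝓡 n) y) {x y : M}
    (hy : y ∈ (extChartAt (𝓡 n) x).source) :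
    chartRep v x (extChartAt (𝓡 n) x y) = tangentCoordChange (𝓡 n) y x y (v y) := by
  rw [chartRep, (extChartAt (𝓡 n) x).left_inv hy]

theorem coordChange_chartRep (v : (y : M) → TangentSpace (𝓡 n) y) {x : M}
    {z : EuclideanSpace ℝ (Fin n)} (hz : z ∈ (extChartAt (𝓡 n) x).target) :
    tangentCoordChange (𝓡 n) x ((extChartAt (𝓡 n) x).symm z) ((extChartAt (𝓡 n) x).symm z)
      (chartRep v x z) = v ((extChartAt (𝓡 n) x).symm z) :=
  coordChange_coordChange (mem_extChartAt_source (I := 𝓡 n) _)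
    ((extChartAt (𝓡 n) x).map_target hz) _

theorem chartRep_eq_zero_iff (v : (y : M) → TangentSpace (𝓡 n) y) {x : M}
    {z : EuclideanSpace ℝ (Fin n)} (hz : z ∈ (extChartAt (𝓡 n) x).target) :
    chartRep v x z = 0 ↔ v ((extChartAt (𝓡 n) x).symm z) = 0 := by
  refine ⟨fun h => ?_, fun h => ?_⟩
  · rw [← coordChange_chartRep v hz, h]
    exact map_zero _
  · rw [chartRep, h]
    exact map_zero _

theorem contMDiffAt_section_iff_chartRep (v : (y : M) → TangentSpace (𝓡 n) y) (x : M) :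
    ContMDiffAt (𝓡 n) (𝓡 n).tangent 1 (fun y => (⟨y, v y⟩ : TangentBundle (𝓡 n) M)) x ↔
      ContDiffAt ℝ 1 (chartRep v x) (extChartAt (𝓡 n) x x) := by
  refine (Bundle.contMDiffAt_section (IB := 𝓡 n) (F := EuclideanSpace ℝ (Fin n))
    (E := fun y : M => TangentSpace (𝓡 n) y) (n := 1) (s := v) x).trans ?_
  rw [contMDiffAt_iff_source_of_mem_source (x' := x) (mem_chart_source _ x)]
  simp only [mfld_simps, contMDiffWithinAt_univ, contMDiffAt_iff_contDiffAt]
  rfl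

theorem hasDerivAt_chart_of_isMIntegralCurve {v : (y : M) → TangentSpace (𝓡 n) y} {γ : ℝ → M}
    (hγ : IsMIntegralCurve (I := 𝓡 n) γ v) {x : M} {t : ℝ}
    (hx : γ t ∈ (extChartAt (𝓡 n) x).source) :
    HasDerivAt (extChartAt (𝓡 n) x ∘ γ) (chartRep v x (extChartAt (𝓡 n) x (γ t))) t := by
  rw [chartRep_extChartAt v hx]
  exact hasDerivAt_chart_of_hasMFDerivAt (hγ t) hx

theorem hasMFDerivAt_extChartAt_symm_comp {v : (y : M) → TangentSpace (𝓡 n) y} {x : M}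
    {z : ℝ → EuclideanSpace ℝ (Fin n)} {t : ℝ} (ht : z t ∈ (extChartAt (𝓡 n) x).target)
    (h : HasDerivAt z (chartRep v x (z t)) t) :
    HasMFDerivAt 𝓘(ℝ, ℝ) (𝓡 n) ((extChartAt (𝓡 n) x).symm ∘ z) t
      ((1 : ℝ →L[ℝ] ℝ).smulRight (v ((extChartAt (𝓡 n) x).symm (z t)))) := by
  have hchart : HasDerivAt (extChartAt (𝓡 n) x ∘ (extChartAt (𝓡 n) x).symm ∘ z)
      (chartRep v x (z t)) t := by
    refine h.congr_of_eventuallyEq ?_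
    filter_upwards [h.continuousAt.preimage_mem_nhds
      ((isOpen_extChartAt_target (I := 𝓡 n) x).mem_nhds ht)] with s hs
    exact (extChartAt (𝓡 n) x).right_inv hs
  refine (hasMFDerivAt_of_hasDerivAt_chart
    ((continuousAt_extChartAt_symm'' ht).comp h.continuousAt)
    ((extChartAt (𝓡 n) x).map_target ht) hchart).congr_mfderiv ?_
  exact congrArg _ (coordChange_chartRep v ht)

end ChartCalculus

section Metric

variable {n : ℕ} {M : Type*} [TopologicalSpace M] [ChartedSpace (EuclideanSpace ℝ (Fin n)) M]
  [IsManifold (𝓡 n) ∞ M]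

theorem inner_grad (g : Metric n M) (f : M → ℝ) (x : M) (w : TangentSpace (𝓡 n) x) :
    g.inner x (grad g f x) w = mfderiv (𝓡 n) 𝓘(ℝ, ℝ) f x w :=
  LinearMap.BilinForm.apply_toDual_symm_apply (B := g.form x)
    (hB := g.form_nondegenerate x) (differential f x) w

theorem grad_eq_zero_iff (g : Metric n M) (f : M → ℝ) (x : M) :
    grad g f x = 0 ↔ IsCriticalPoint (n := n) f x := by
  rw [grad, LinearEquiv.map_eq_zero_iff]
  exact ContinuousLinearMap.coe_injective.eq_iff' rfl

theorem grad_neg (g : Metric n M) (f : M → ℝ) (x : M) : grad g (-f) x = -grad g f x := by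
  have hneg : differential (n := n) (-f) x = -differential f x :=
    congrArg ContinuousLinearMap.toLinearMap (mfderiv_neg (I := 𝓡 n) (f := f))
  rw [grad, grad, hneg, map_neg]

/-- The metric `g` in the preferred chart around `x`, as a bilinear form on the model space. -/
def chartMetric (g : Metric n M) (x : M) (z : EuclideanSpace ℝ (Fin n)) :
    EuclideanSpace ℝ (Fin n) →L[ℝ] EuclideanSpace ℝ (Fin n) →L[ℝ] ℝ :=
  let y := (extChartAt (𝓡 n) x).symm z
  ContinuousLinearMap.bilinearComp
    (g.inner y : EuclideanSpace ℝ (Fin n) →L[ℝ] EuclideanSpace ℝ (Fin n) →L[ℝ] ℝ)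
    (tangentCoordChange (𝓡 n) x y y) (tangentCoordChange (𝓡 n) x y y)

theorem chartMetric_pos (g : Metric n M) {x : M} {z : EuclideanSpace ℝ (Fin n)}
    (hz : z ∈ (extChartAt (𝓡 n) x).target) {a : EuclideanSpace ℝ (Fin n)} (ha : a ≠ 0) :
    0 < chartMetric g x z a a := by
  refine g.pos _ _ fun h => ha ?_
  rw [← coordChange_coordChange ((extChartAt (𝓡 n) x).map_target hz)
    (mem_extChartAt_source (I := 𝓡 n) ((extChartAt (𝓡 n) x).symm z)) a]
  exact (congrArg _ h).trans (map_zero _)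

theorem chartMetric_symm (g : Metric n M) (x : M) (z a b : EuclideanSpace ℝ (Fin n)) :
    chartMetric g x z a b = chartMetric g x z b a :=
  g.symm _ _ _

theorem contMDiffAt_coordChange_const (x : M) (a : EuclideanSpace ℝ (Fin n)) :
    ContMDiffAt (𝓡 n) (𝓡 n).tangent ∞
      (fun y => (⟨y, tangentCoordChange (𝓡 n) x y y a⟩ : TangentBundle (𝓡 n) M)) x := by
  refine (Bundle.contMDiffAt_section (IB := 𝓡 n) (F := EuclideanSpace ℝ (Fin n))
    (E := fun y : M => TangentSpace (𝓡 n) y) (n := ∞)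
    (s := fun y => tangentCoordChange (𝓡 n) x y y a) x).2 ?_
  refine (contMDiffAt_const (c := a)).congr_of_eventuallyEq ?_
  filter_upwards [extChartAt_source_mem_nhds (I := 𝓡 n) x] with y hy
  exact coordChange_coordChange hy (mem_extChartAt_source (I := 𝓡 n) y) a

theorem contDiffAt_chartMetric (g : Metric n M) (x : M) :
    ContDiffAt ℝ ∞ (chartMetric g x) (extChartAt (𝓡 n) x x) := by
  refine contDiffAt_clm_of_apply fun a => contDiffAt_clm_of_apply fun b => ?_
  have hbundle : ContMDiffAt (𝓡 n) ((𝓡 n).prod 𝓘(ℝ, ℝ)) ∞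
      (fun y => Bundle.TotalSpace.mk' ℝ (E := Bundle.Trivial M ℝ) y
        (g.inner y (tangentCoordChange (𝓡 n) x y y a) (tangentCoordChange (𝓡 n) x y y b))) x :=
    ContMDiffAt.clm_bundle_apply₂ (F₁ := EuclideanSpace ℝ (Fin n))
      (F₂ := EuclideanSpace ℝ (Fin n)) (E₁ := fun y : M => TangentSpace (𝓡 n) y)
      (E₂ := fun y : M => TangentSpace (𝓡 n) y) g.contMDiff.contMDiffAt
      (contMDiffAt_coordChange_const x a) (contMDiffAt_coordChange_const x b)
  rw [Bundle.contMDiffAt_totalSpace] at hbundle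
  exact contDiffAt_comp_extChartAt_symm hbundle.2

end Metric

section ChartGradient

variable {n : ℕ} {M : Type*} [TopologicalSpace M] [ChartedSpace (EuclideanSpace ℝ (Fin n)) M]

/-- The Hessian of `f` at `x` in the preferred chart around `x`, as a bilinear form; its matrix in
the standard basis is `hessian f x`. -/
def chartHessian (f : M → ℝ) (x : M) :
    EuclideanSpace ℝ (Fin n) →L[ℝ] EuclideanSpace ℝ (Fin n) →L[ℝ] ℝ :=
  fderiv ℝ (fderiv ℝ (f ∘ (extChartAt (𝓡 n) x).symm)) (extChartAt (𝓡 n) x x)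

theorem eq_zero_of_chartHessian_eq_zero {f : M → ℝ} {x : M}
    (hd : (hessian (n := n) f x).det ≠ 0) {a : EuclideanSpace ℝ (Fin n)}
    (ha : chartHessian f x a = 0) : a = 0 := by
  have hsum : a = ∑ i, a i • EuclideanSpace.single i (1 : ℝ) := by
    simpa using ((EuclideanSpace.basisFun (Fin n) ℝ).sum_repr a).symm
  have hvec : Matrix.vecMul (WithLp.ofLp a) (hessian f x) = 0 := by
    ext j
    have hj : chartHessian f x a (EuclideanSpace.single j 1) = 0 := by rw [ha]; rfl
    rw [hsum] at hj
    simpa [Matrix.vecMul, dotProduct, hessian, chartHessian] using hj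
  ext i
  exact congrFun (Matrix.eq_zero_of_vecMul_eq_zero hd hvec) i

variable [IsManifold (𝓡 n) ∞ M]

theorem hasFDerivAt_fderiv_chart {f : M → ℝ} {x : M} (hf : ContMDiffAt (𝓡 n) 𝓘(ℝ, ℝ) ∞ f x) :
    HasFDerivAt (fderiv ℝ (f ∘ (extChartAt (𝓡 n) x).symm)) (chartHessian f x)
      (extChartAt (𝓡 n) x x) :=
  (((contDiffAt_comp_extChartAt_symm hf).fderiv_right (m := ∞) (by simp)).differentiableAt
    (by simp)).hasFDerivAt

theorem chartHessian_symm {f : M → ℝ} {x : M} (hf : ContMDiffAt (𝓡 n) 𝓘(ℝ, ℝ) ∞ f x)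
    (a b : EuclideanSpace ℝ (Fin n)) : chartHessian f x a b = chartHessian f x b a :=
  (contDiffAt_comp_extChartAt_symm hf).isSymmSndFDerivAt
    (by rw [minSmoothness_of_isRCLikeNormedField]; exact ENat.LEInfty.out) a b

theorem mfderiv_coordChange {f : M → ℝ} {x : M} {z : EuclideanSpace ℝ (Fin n)}
    (hz : z ∈ (extChartAt (𝓡 n) x).target)
    (hf : MDifferentiableAt (𝓡 n) 𝓘(ℝ, ℝ) f ((extChartAt (𝓡 n) x).symm z))
    (b : EuclideanSpace ℝ (Fin n)) :
    mfderiv (𝓡 n) 𝓘(ℝ, ℝ) f ((extChartAt (𝓡 n) x).symm z) (tangentCoordChange (𝓡 n) x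
      ((extChartAt (𝓡 n) x).symm z) ((extChartAt (𝓡 n) x).symm z) b) =
      fderiv ℝ (f ∘ (extChartAt (𝓡 n) x).symm) z b := by
  set y := (extChartAt (𝓡 n) x).symm z
  let df : EuclideanSpace ℝ (Fin n) →L[ℝ] ℝ := mfderiv (𝓡 n) 𝓘(ℝ, ℝ) f y
  have hsource : y ∈ (extChartAt (𝓡 n) x).source := (extChartAt (𝓡 n) x).map_target hz
  have hchange := hasFDerivAt_coordChange hsource (mem_extChartAt_source (I := 𝓡 n) y)
  rw [(extChartAt (𝓡 n) x).right_inv hz] at hchange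
  have hfy := hf.hasMFDerivAt.2
  rw [ModelWithCorners.range_eq_univ] at hfy
  have hdf : HasFDerivAt (f ∘ (extChartAt (𝓡 n) y).symm) df
      ((extChartAt (𝓡 n) y ∘ (extChartAt (𝓡 n) x).symm) z) := hasFDerivWithinAt_univ.1 hfy
  have hcomp : HasFDerivAt (f ∘ (extChartAt (𝓡 n) x).symm)
      (df.comp (tangentCoordChange (𝓡 n) x y y)) z := by
    refine (hdf.comp z hchange).congr_of_eventuallyEq ?_
    have hc : ContinuousAt (extChartAt (𝓡 n) x).symm z := continuousAt_extChartAt_symm'' hz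
    filter_upwards [hc.preimage_mem_nhds (extChartAt_source_mem_nhds (I := 𝓡 n) y)] with w hw
    exact congrArg f ((extChartAt (𝓡 n) y).left_inv hw).symm
  exact (DFunLike.congr_fun hcomp.fderiv b).symm

/-- The negative gradient field of `f`, read in the preferred chart around `x`. -/
def chartField (g : Metric n M) (f : M → ℝ) (x : M) :
    EuclideanSpace ℝ (Fin n) → EuclideanSpace ℝ (Fin n) :=
  chartRep (fun y => -grad g f y) x

theorem chartField_eq_zero_iff (g : Metric n M) {f : M → ℝ} {x : M}
    {z : EuclideanSpace ℝ (Fin n)} (hz : z ∈ (extChartAt (𝓡 n) x).target) :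
    chartField g f x z = 0 ↔ IsCriticalPoint (n := n) f ((extChartAt (𝓡 n) x).symm z) :=
  (chartRep_eq_zero_iff _ hz).trans (neg_eq_zero.trans (grad_eq_zero_iff g f _))

theorem chartField_extChartAt_self (g : Metric n M) {f : M → ℝ} {x : M}
    (hx : IsCriticalPoint (n := n) f x) : chartField g f x (extChartAt (𝓡 n) x x) = 0 := by
  rwa [chartField_eq_zero_iff g (mem_extChartAt_target x), extChartAt_to_inv]

theorem chartField_neg (g : Metric n M) (f : M → ℝ) (x : M) :
    chartField g (-f) x = -chartField g f x := by
  funext z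
  have h := grad_neg g f ((extChartAt (𝓡 n) x).symm z)
  simp only [chartField, chartRep, Pi.neg_apply, h]
  exact map_neg _ _

theorem chartMetric_chartField (g : Metric n M) {f : M → ℝ} {x : M}
    {z : EuclideanSpace ℝ (Fin n)} (hz : z ∈ (extChartAt (𝓡 n) x).target)
    (hf : MDifferentiableAt (𝓡 n) 𝓘(ℝ, ℝ) f ((extChartAt (𝓡 n) x).symm z)) :
    chartMetric g x z (chartField g f x z) = -fderiv ℝ (f ∘ (extChartAt (𝓡 n) x).symm) z := by
  ext b
  set y := (extChartAt (𝓡 n) x).symm z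
  set w : TangentSpace (𝓡 n) y := tangentCoordChange (𝓡 n) x y y b
  calc chartMetric g x z (chartField g f x z) b
      = g.inner y (-grad g f y) w :=
        congrArg (fun v : TangentSpace (𝓡 n) y => g.inner y v w) (coordChange_chartRep _ hz)
    _ = -g.inner y (grad g f y) w := DFunLike.congr_fun (map_neg (g.inner y) _) w
    _ = -fderiv ℝ (f ∘ (extChartAt (𝓡 n) x).symm) z b :=
        congrArg Neg.neg ((inner_grad g f y w).trans (mfderiv_coordChange hz hf b))

theorem contDiffAt_chartField (g : Metric n M) {f : M → ℝ} (hf : ContMDiff (𝓡 n) 𝓘(ℝ, ℝ) ∞ f)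
    (x : M) : ContDiffAt ℝ ∞ (chartField g f x) (extChartAt (𝓡 n) x x) := by
  have hinv : ∀ z ∈ (extChartAt (𝓡 n) x).target, (chartMetric g x z).IsInvertible :=
    fun z hz => isInvertible_of_pos fun a ha => chartMetric_pos g hz ha
  have hsmooth : ContDiffAt ℝ ∞ (fun z => (chartMetric g x z).inverse
      (-fderiv ℝ (f ∘ (extChartAt (𝓡 n) x).symm) z)) (extChartAt (𝓡 n) x x) :=
    ((hinv _ (mem_extChartAt_target x)).contDiffAt_map_inverse.comp _
      (contDiffAt_chartMetric g x)).clm_apply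
      ((contDiffAt_comp_extChartAt_symm (hf x)).fderiv_right (m := ∞) (by simp)).neg
  refine hsmooth.congr_of_eventuallyEq ?_
  filter_upwards [extChartAt_target_mem_nhds (I := 𝓡 n) x] with z hz
  rw [← chartMetric_chartField g hz (hf.mdifferentiableAt (by simp))]
  obtain ⟨e, he⟩ := hinv z hz
  simp [← he]

theorem contMDiff_neg_grad (g : Metric n M) {f : M → ℝ} (hf : ContMDiff (𝓡 n) 𝓘(ℝ, ℝ) ∞ f) :
    ContMDiff (𝓡 n) (𝓡 n).tangent 1
      (fun y => (⟨y, -grad g f y⟩ : TangentBundle (𝓡 n) M)) := fun x =>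
  (contMDiffAt_section_iff_chartRep (fun y => -grad g f y) x).2
    ((contDiffAt_chartField g hf x).of_le (by simp))

/-- The linearization at `x` of the negative gradient field, in the preferred chart. -/
def linearization (g : Metric n M) (f : M → ℝ) (x : M) :
    EuclideanSpace ℝ (Fin n) →L[ℝ] EuclideanSpace ℝ (Fin n) :=
  fderiv ℝ (chartField g f x) (extChartAt (𝓡 n) x x)

theorem linearization_neg (g : Metric n M) (f : M → ℝ) (x : M) :
    linearization g (-f) x = -linearization g f x := by
  rw [linearization, chartField_neg, fderiv_neg, linearization]

theorem hasStrictFDerivAt_chartField (g : Metric n M) {f : M → ℝ}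
    (hf : ContMDiff (𝓡 n) 𝓘(ℝ, ℝ) ∞ f) (x : M) :
    HasStrictFDerivAt (chartField g f x) (linearization g f x) (extChartAt (𝓡 n) x x) :=
  (contDiffAt_chartField g hf x).hasStrictFDerivAt (by simp)

theorem chartMetric_linearization (g : Metric n M) {f : M → ℝ}
    (hf : ContMDiff (𝓡 n) 𝓘(ℝ, ℝ) ∞ f) {x : M} (hx : IsCriticalPoint (n := n) f x)
    (a : EuclideanSpace ℝ (Fin n)) :
    chartMetric g x (extChartAt (𝓡 n) x x) (linearization g f x a) = -chartHessian f x a := by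
  have hprod := ((contDiffAt_chartMetric g x).differentiableAt (by simp)).hasFDerivAt.clm_apply
    (hasStrictFDerivAt_chartField g hf x).hasFDerivAt
  have heq : (fun z => chartMetric g x z (chartField g f x z)) =ᶠ[𝓝 (extChartAt (𝓡 n) x x)]
      fun z => -fderiv ℝ (f ∘ (extChartAt (𝓡 n) x).symm) z := by
    filter_upwards [extChartAt_target_mem_nhds (I := 𝓡 n) x] with z hz
    exact chartMetric_chartField g hz (hf.mdifferentiableAt (by simp))
  have hderiv := DFunLike.congr_fun
    (hprod.unique ((hasFDerivAt_fderiv_chart (hf x)).neg.congr_of_eventuallyEq heq)) a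
  simpa only [_root_.add_apply, ContinuousLinearMap.comp_apply,
    ContinuousLinearMap.flip_apply, _root_.neg_apply,
    chartField_extChartAt_self g hx, map_zero, add_zero] using hderiv

theorem eventually_not_isCriticalPoint {f : M → ℝ} {x : M}
    (hf : ContMDiff (𝓡 n) 𝓘(ℝ, ℝ) ∞ f) (hd : (hessian (n := n) f x).det ≠ 0) :
    ∀ᶠ y in 𝓝[≠] x, ¬ IsCriticalPoint (n := n) f y := by
  obtain ⟨K, -, hK⟩ := LinearMap.exists_antilipschitzWith (chartHessian f x).toLinearMap
    (LinearMap.ker_eq_bot'.2 fun a ha => eq_zero_of_chartHessian_eq_zero hd ha)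
  have hne := (hasFDerivAt_fderiv_chart (hf x)).eventually_ne (c := 0) ⟨K, hK⟩
  rw [eventually_nhdsWithin_iff] at hne ⊢
  filter_upwards [(continuousAt_extChartAt (I := 𝓡 n) x).eventually hne,
    extChartAt_source_mem_nhds (I := 𝓡 n) x] with y hy hys hyx hcrit
  refine hy (fun h => hyx ((extChartAt (𝓡 n) x).injOn hys (mem_extChartAt_source x) h)) ?_
  have hcrit' : IsCriticalPoint (n := n) f
      ((extChartAt (𝓡 n) x).symm (extChartAt (𝓡 n) x y)) := by
    rwa [(extChartAt (𝓡 n) x).left_inv hys]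
  ext b
  rw [← mfderiv_coordChange ((extChartAt (𝓡 n) x).map_source hys)
    (hf.mdifferentiableAt (by simp)) b, hcrit']
  rfl

end ChartGradient

theorem exists_pos_forall_of_locally {X : Type*} [TopologicalSpace X] [CompactSpace X]
    {P : ℝ → X → Prop} (hanti : ∀ {δ ε x}, δ ≤ ε → P ε x → P δ x)
    (hloc : ∀ x, ∃ ε > 0, ∀ᶠ y in 𝓝 x, P ε y) : ∃ ε > 0, ∀ x, P ε x := by
  suffices h : ∃ ε > 0, ∀ x ∈ (univ : Set X), P ε x by simpa using h
  refine isCompact_univ.induction_on (p := fun s => ∃ ε > 0, ∀ x ∈ s, P ε x)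
    ⟨1, one_pos, by simp⟩ (fun s t hst ⟨ε, hε, h⟩ => ⟨ε, hε, fun x hx => h x (hst hx)⟩)
    (fun s t ⟨ε, hε, hs⟩ ⟨δ, hδ, ht⟩ => ⟨min ε δ, lt_min hε hδ, ?_⟩) fun x _ => ?_
  · rintro x (hx | hx)
    · exact hanti (min_le_left _ _) (hs x hx)
    · exact hanti (min_le_right _ _) (ht x hx)
  · obtain ⟨ε, hε, h⟩ := hloc x
    exact ⟨_, mem_nhdsWithin_of_mem_nhds h, ε, hε, fun y hy => hy⟩

theorem continuous_uncurry_of_continuousAt_Ioo {X : Type*} [TopologicalSpace X]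
    {Φ : ℝ → X → X} (hadd : ∀ s t x, Φ (s + t) x = Φ s (Φ t x)) (hzero : ∀ x, Φ 0 x = x)
    {δ : ℝ} (hδ : 0 < δ)
    (hc : ∀ x, ∀ t ∈ Ioo (-δ) δ, ContinuousAt (Function.uncurry Φ) (t, x)) :
    Continuous (Function.uncurry Φ) := by
  let S : AddSubmonoid ℝ :=
    { carrier := {t | Continuous (Φ t)}
      zero_mem' := continuous_id.congr fun x => (hzero x).symm
      add_mem' := fun {s t} hs ht => (hs.comp ht).congr fun x => (hadd s t x).symm }
  have hsmall : ∀ t ∈ Ioo (-δ) δ, t ∈ S := fun t ht => continuous_iff_continuousAt.2 fun x =>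
    (hc x t ht).comp (Continuous.prodMk_right t).continuousAt
  have hall : ∀ t, Continuous (Φ t) := fun t => by
    obtain ⟨N, hN⟩ := exists_nat_gt (|t| / δ)
    have hN0 : (0 : ℝ) < N := lt_of_le_of_lt (by positivity) hN
    have hmem : t / N ∈ Ioo (-δ) δ := by
      rw [mem_Ioo, ← abs_lt, abs_div, abs_of_pos hN0, div_lt_iff₀ hN0]
      rw [div_lt_iff₀ hδ] at hN
      linarith
    have hsum : N • (t / N) = t := by rw [nsmul_eq_mul, mul_div_cancel₀ _ hN0.ne']
    exact hsum ▸ S.nsmul_mem (hsmall _ hmem) N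
  refine continuous_iff_continuousAt.2 fun ⟨T, x⟩ => ?_
  have hshift : Function.uncurry Φ =
      Φ T ∘ Function.uncurry Φ ∘ fun q : ℝ × X => (q.1 - T, q.2) := by
    funext q
    simp [Function.uncurry, ← hadd]
  rw [hshift]
  refine (hall T).continuousAt.comp (ContinuousAt.comp ?_ (by fun_prop))
  simpa using hc x 0 ⟨neg_lt_zero.2 hδ, hδ⟩

theorem exists_local_flow_of_contDiffAt {E : Type*} [NormedAddCommGroup E] [NormedSpace ℝ E]
    [CompleteSpace E] {X : E → E} {z₀ : E} (hX : ContDiffAt ℝ 1 X z₀) {W : Set E}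
    (hW : W ∈ 𝓝 z₀) :
    ∃ ε > (0 : ℝ), ∃ N ∈ 𝓝 z₀, ∃ β : E × ℝ → E,
      (∀ z ∈ N, β (z, 0) = z ∧
        ∀ t ∈ Ioo (-ε) ε, HasDerivAt (fun t => β (z, t)) (X (β (z, t))) t) ∧
      ContinuousOn β (N ×ˢ Ioo (-ε) ε) ∧ MapsTo β (N ×ˢ Ioo (-ε) ε) W := by
  obtain ⟨ε, hε, a, r, L, K, hr, hpl⟩ := IsPicardLindelof.of_contDiffAt_one hX
  obtain ⟨β, hβ, hβc⟩ := (hpl 0).exists_forall_mem_closedBall_eq_hasDerivWithinAt_continuousOn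
  simp only [zero_sub, zero_add] at hβ hβc
  have hr' : (0 : ℝ) < r := hr
  have hcont : ContinuousAt β (z₀, 0) := hβc.continuousAt
    (prod_mem_nhds (Metric.closedBall_mem_nhds _ hr') (Icc_mem_nhds (neg_lt_zero.2 hε) hε))
  have hβW : β ⁻¹' W ∈ 𝓝 (z₀, (0 : ℝ)) := hcont.preimage_mem_nhds
    (by rwa [(hβ z₀ (Metric.mem_closedBall_self hr'.le)).1])
  obtain ⟨N, hN, T, hT, hNT⟩ := mem_nhds_prod_iff.1 hβW
  obtain ⟨δ, hδ, hδT⟩ := Metric.mem_nhds_iff.1 hT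
  rw [Real.ball_eq_Ioo, zero_sub, zero_add] at hδT
  have hIoo : Ioo (-min δ ε) (min δ ε) ⊆ Ioo (-δ) δ ∩ Ioo (-ε) ε := subset_inter
    (Ioo_subset_Ioo (neg_le_neg (min_le_left _ _)) (min_le_left _ _))
    (Ioo_subset_Ioo (neg_le_neg (min_le_right _ _)) (min_le_right _ _))
  refine ⟨min δ ε, lt_min hδ hε, N ∩ Metric.closedBall z₀ r,
    inter_mem hN (Metric.closedBall_mem_nhds _ hr'), β, fun z hz => ⟨(hβ z hz.2).1,
      fun t ht => ?_⟩, hβc.mono (prod_mono inter_subset_right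
        (hIoo.trans (inter_subset_right.trans Ioo_subset_Icc_self))),
    fun q hq => hNT ⟨hq.1.1, hδT (hIoo hq.2).1⟩⟩
  exact ((hβ z hz.2).2 t (Ioo_subset_Icc_self (hIoo ht).2)).hasDerivAt
    (Icc_mem_nhds (hIoo ht).2.1 (hIoo ht).2.2)

section Flow

variable {n : ℕ} {M : Type*} [TopologicalSpace M] [ChartedSpace (EuclideanSpace ℝ (Fin n)) M]
  [IsManifold (𝓡 n) 1 M] {v : (y : M) → TangentSpace (𝓡 n) y}

theorem exists_local_flow
    (hv : ContMDiff (𝓡 n) (𝓡 n).tangent 1 (fun y => (⟨y, v y⟩ : TangentBundle (𝓡 n) M))) (x : M) :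
    ∃ ε > (0 : ℝ), ∃ U, IsOpen U ∧ x ∈ U ∧ ∃ α : ℝ × M → M,
      (∀ y ∈ U, α (0, y) = y ∧ IsMIntegralCurveOn (fun t => α (t, y)) v (Ioo (-ε) ε)) ∧
      ContinuousOn α (Ioo (-ε) ε ×ˢ U) := by
  obtain ⟨ε, hε, N, hN, β, hβ, hβc, hβmem⟩ := exists_local_flow_of_contDiffAt
    ((contMDiffAt_section_iff_chartRep v x).1 (hv x)) (extChartAt_target_mem_nhds (I := 𝓡 n) x)
  obtain ⟨U, hU, hUo, hxU⟩ := mem_nhds_iff.1 (inter_mem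
    (extChartAt_source_mem_nhds (I := 𝓡 n) x) ((continuousAt_extChartAt x).preimage_mem_nhds hN))
  have hUN : ∀ y ∈ U, extChartAt (𝓡 n) x y ∈ N := fun y hy => (hU hy).2
  refine ⟨ε, hε, U, hUo, hxU, fun q => (extChartAt (𝓡 n) x).symm (β (extChartAt (𝓡 n) x q.2, q.1)),
    fun y hy => ⟨?_, fun t ht => ?_⟩, ?_⟩
  · simp only [(hβ _ (hUN y hy)).1, (extChartAt (𝓡 n) x).left_inv (hU hy).1]
  · exact (hasMFDerivAt_extChartAt_symm_comp (hβmem ⟨hUN y hy, ht⟩)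
      ((hβ _ (hUN y hy)).2 t ht)).hasMFDerivWithinAt
  · refine (continuousOn_extChartAt_symm x).comp (hβc.comp (.prodMk ?_
      continuous_fst.continuousOn) ?_) fun q hq => hβmem ⟨hUN _ hq.2, hq.1⟩
    · exact (continuousOn_extChartAt x).comp continuous_snd.continuousOn fun q hq => (hU hq.2).1
    · exact fun q hq => ⟨hUN _ hq.2, hq.1⟩

variable [T2Space M] [CompactSpace M]

theorem exists_isMIntegralCurve
    (hv : ContMDiff (𝓡 n) (𝓡 n).tangent 1 (fun y => (⟨y, v y⟩ : TangentBundle (𝓡 n) M))) (x : M) :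
    ∃ γ : ℝ → M, γ 0 = x ∧ IsMIntegralCurve (I := 𝓡 n) γ v := by
  obtain ⟨ε, hε, h⟩ := exists_pos_forall_of_locally
    (P := fun ε y => ∃ γ : ℝ → M, γ 0 = y ∧ IsMIntegralCurveOn γ v (Ioo (-ε) ε))
    (fun hle ⟨γ, h0, hγ⟩ => ⟨γ, h0, hγ.mono (Ioo_subset_Ioo (neg_le_neg hle) hle)⟩)
    fun x => by
      obtain ⟨ε, hε, U, hUo, hxU, α, hα, -⟩ := exists_local_flow hv x
      refine ⟨ε, hε, ?_⟩
      filter_upwards [hUo.mem_nhds hxU] with y hy using ⟨fun t => α (t, y), hα y hy⟩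
  exact exists_isMIntegralCurve_of_isMIntegralCurveOn hv hε h x

theorem exists_flow_isMIntegralCurve
    (hv : ContMDiff (𝓡 n) (𝓡 n).tangent 1 (fun y => (⟨y, v y⟩ : TangentBundle (𝓡 n) M))) :
    ∃ φ : Flow ℝ M, ∀ y, IsMIntegralCurve (I := 𝓡 n) (fun t => φ t y) v := by
  choose Φ hΦ0 hΦ using exists_isMIntegralCurve hv
  have hadd : ∀ s t y, Φ y (s + t) = Φ (Φ y t) s := fun s t y =>
    congrFun (isMIntegralCurve_Ioo_eq_of_contMDiff_boundaryless (t₀ := 0) hv ((hΦ y).comp_add t)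
      (hΦ (Φ y t)) (by simp [hΦ0])) s
  obtain ⟨δ, hδ, hc⟩ := exists_pos_forall_of_locally
    (P := fun δ y => ∀ t ∈ Ioo (-δ) δ, ContinuousAt (fun q : ℝ × M => Φ q.2 q.1) (t, y))
    (fun hle h t ht => h t (Ioo_subset_Ioo (neg_le_neg hle) hle ht)) fun x => by
      obtain ⟨δ, hδ, U, hUo, hxU, α, hα, hαc⟩ := exists_local_flow hv x
      refine ⟨δ, hδ, ?_⟩
      filter_upwards [hUo.mem_nhds hxU] with y hy t ht
      have hmem := prod_mem_nhds (Ioo_mem_nhds ht.1 ht.2) (hUo.mem_nhds hy)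
      refine (hαc.continuousAt hmem).congr ?_
      filter_upwards [hmem] with q hq
      exact isMIntegralCurveOn_Ioo_eqOn_of_contMDiff_boundaryless (t₀ := 0)
        ⟨neg_lt_zero.2 hδ, hδ⟩ hv (hα q.2 hq.2).2 ((hΦ q.2).isMIntegralCurveOn _)
        (by rw [(hα q.2 hq.2).1, hΦ0]) hq.1
  exact ⟨{ toFun := fun t y => Φ y t
           cont' := continuous_uncurry_of_continuousAt_Ioo hadd hΦ0 hδ hc
           map_add' := hadd
           map_zero' := hΦ0 }, hΦ⟩

end Flow

theorem subset_of_isPreconnected_of_disjoint_frontier {X : Type*} [TopologicalSpace X]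
    {S W : Set X} (hS : IsPreconnected S) (hd : Disjoint (frontier W) S)
    (hne : (S ∩ W).Nonempty) : S ⊆ W := by
  have : PreconnectedSpace S := isPreconnected_iff_preconnectedSpace.1 hS
  obtain ⟨x, hxS, hxW⟩ := hne
  have hxint : x ∈ interior W :=
    by_contra fun h => disjoint_right.1 hd hxS ⟨subset_closure hxW, h⟩
  have huniv := (isClopen_preimage_val isOpen_interior
    (hd.mono_left frontier_interior_subset)).eq_univ ⟨⟨x, hxS⟩, hxint⟩
  exact fun y hy => interior_subset (huniv.ge (mem_univ (⟨y, hy⟩ : S)))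

theorem ne_of_mem_frontier {X : Type*} [TopologicalSpace X] {W : Set X} {p z : X} (hW : W ∈ 𝓝 p)
    (hz : z ∈ frontier W) : z ≠ p := fun h =>
  hz.2 (mem_interior_iff_mem_nhds.2 (h ▸ hW))

section TrappedSet

variable {X : Type*} [TopologicalSpace X]

/-- The points of `W` whose forward orbit stays in `W`. -/
def trappedSet (φ : Flow ℝ X) (W : Set X) : Set X :=
  {y | ∀ t, 0 ≤ t → φ t y ∈ W}

theorem trappedSet_subset (φ : Flow ℝ X) (W : Set X) : trappedSet φ W ⊆ W := fun y hy => by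
  simpa using hy 0 le_rfl

theorem trappedSet_mono (φ : Flow ℝ X) {V W : Set X} (h : V ⊆ W) :
    trappedSet φ V ⊆ trappedSet φ W := fun _ hy t ht => h (hy t ht)

theorem apply_mem_trappedSet {φ : Flow ℝ X} {W : Set X} {y : X} (hy : y ∈ trappedSet φ W) {t : ℝ}
    (ht : 0 ≤ t) : φ t y ∈ trappedSet φ W := fun r hr => by
  rw [← φ.map_add]
  exact hy _ (add_nonneg hr ht)

theorem mem_trappedSet_of_forall_notMem_frontier (φ : Flow ℝ X) {W : Set X} {y : X}
    (hW : ∀ t, 0 ≤ t → φ t y ∉ frontier W) (hne : ∃ t, 0 ≤ t ∧ φ t y ∈ W) :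
    y ∈ trappedSet φ W := fun t ht => by
  have hcont : Continuous fun t => φ t y := φ.continuous continuous_id continuous_const
  obtain ⟨s, hs, hsW⟩ := hne
  refine subset_of_isPreconnected_of_disjoint_frontier
    (isPreconnected_Ici.image (fun t => φ t y) hcont.continuousOn (s := Ici 0))
    (disjoint_right.2 ?_) ⟨_, mem_image_of_mem _ hs, hsW⟩ (mem_image_of_mem _ ht)
  rintro _ ⟨r, hr, rfl⟩
  exact hW r hr

end TrappedSet

section Critical

variable {n : ℕ} {M : Type*} [TopologicalSpace M] [ChartedSpace (EuclideanSpace ℝ (Fin n)) M]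
  {f : M → ℝ} {x : M}

theorem isCriticalPoint_neg_iff :
    IsCriticalPoint (n := n) (-f) x ↔ IsCriticalPoint (n := n) f x := by
  rw [IsCriticalPoint, mfderiv_neg]
  exact neg_eq_zero (a := mfderiv (𝓡 n) 𝓘(ℝ, ℝ) f x)

theorem chartHessian_neg (f : M → ℝ) (x : M) :
    chartHessian (n := n) (-f) x = -chartHessian f x := by
  have hchart : (-f) ∘ (extChartAt (𝓡 n) x).symm = -(f ∘ (extChartAt (𝓡 n) x).symm) := rfl
  have hderiv : fderiv ℝ (-(f ∘ (extChartAt (𝓡 n) x).symm)) =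
      -fderiv ℝ (f ∘ (extChartAt (𝓡 n) x).symm) := funext fun _ => fderiv_neg
  rw [chartHessian, hchart, hderiv, fderiv_neg, chartHessian]

theorem hessian_neg (f : M → ℝ) (x : M) : hessian (n := n) (-f) x = -hessian f x :=
  Matrix.ext fun i j => congrArg
    (fun B => B (EuclideanSpace.single i 1) (EuclideanSpace.single j 1)) (chartHessian_neg f x)

theorem det_hessian_neg_ne_zero (hd : (hessian (n := n) f x).det ≠ 0) :
    (hessian (n := n) (-f) x).det ≠ 0 := by
  rw [hessian_neg, Matrix.det_neg]
  exact mul_ne_zero (pow_ne_zero _ (neg_ne_zero.2 one_ne_zero)) hd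

theorem isCriticalPoint_of_isLocalExtr (hf : MDifferentiableAt (𝓡 n) 𝓘(ℝ, ℝ) f x)
    (hx : IsLocalExtr f x) : IsCriticalPoint (n := n) f x := by
  have hchart : IsLocalExtr (f ∘ (extChartAt (𝓡 n) x).symm) (extChartAt (𝓡 n) x x) :=
    IsExtrFilter.comp_tendsto (by rwa [extChartAt_to_inv])
      ((continuousAt_extChartAt_symm x).tendsto.trans (by rw [extChartAt_to_inv]))
  rw [IsCriticalPoint, hf.mfderiv, ModelWithCorners.range_eq_univ, fderivWithin_univ]
  exact hchart.fderiv_eq_zero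

variable [IsManifold (𝓡 n) ∞ M]

theorem eventually_lt_of_isLocalMin (hf : ContMDiff (𝓡 n) 𝓘(ℝ, ℝ) ∞ f)
    (hd : (hessian (n := n) f x).det ≠ 0) (hx : IsLocalMin f x) : ∀ᶠ y in 𝓝[≠] x, f x < f y := by
  filter_upwards [eventually_not_isCriticalPoint hf hd,
    (eventually_eventually_nhds.2 hx).filter_mono nhdsWithin_le_nhds] with y hy hmin
  refine hmin.self_of_nhds.lt_of_ne fun heq => hy ?_
  exact isCriticalPoint_of_isLocalExtr (hf.mdifferentiable (by simp) y)
    (Or.inl (hmin.mono fun z hz => heq ▸ hz))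

end Critical

section FlowLine

variable {n : ℕ} {M : Type*} [TopologicalSpace M] [ChartedSpace (EuclideanSpace ℝ (Fin n)) M]
  [IsManifold (𝓡 n) ∞ M] {g : Metric n M} {f : M → ℝ}

theorem IsFlowLine.comp_neg {γ : ℝ → M} (hγ : IsFlowLine g f γ) :
    IsFlowLine g (-f) (fun t => γ (-t)) := by
  have hrev := IsMIntegralCurve.comp_mul hγ (-1)
  have hfield : ((-1 : ℝ) • fun x => -grad g f x) = fun x => -grad g (-f) x := by
    funext x
    rw [grad_neg, Pi.smul_apply, neg_one_smul]
  simpa only [IsFlowLine, hfield, Function.comp_def, mul_neg_one] using hrev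

theorem stable_neg (g : Metric n M) (f : M → ℝ) (p : M) :
    stable g (-f) p = unstable g f p := by
  ext y
  refine ⟨fun ⟨γ, hγ, h0, hp⟩ => ⟨fun t => γ (-t), by simpa using hγ.comp_neg, by simpa using h0,
    hp.comp tendsto_neg_atBot_atTop⟩, fun ⟨γ, hγ, h0, hp⟩ => ⟨fun t => γ (-t), hγ.comp_neg,
    by simpa using h0, hp.comp tendsto_neg_atTop_atBot⟩⟩

/-- `φ` is the negative gradient flow of `f`: its orbits are flow lines, and the only ones. -/
structure IsGradFlow (g : Metric n M) (f : M → ℝ) (φ : Flow ℝ M) : Prop where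
  isFlowLine : ∀ y, IsFlowLine g f (fun t => φ t y)
  eq_of_isFlowLine : ∀ γ, IsFlowLine g f γ → ∀ t, γ t = φ t (γ 0)

theorem exists_isGradFlow [T2Space M] [CompactSpace M] (g : Metric n M)
    (hf : ContMDiff (𝓡 n) 𝓘(ℝ, ℝ) ∞ f) : ∃ φ, IsGradFlow g f φ := by
  obtain ⟨φ, hφ⟩ := exists_flow_isMIntegralCurve (contMDiff_neg_grad g hf)
  exact ⟨φ, hφ, fun γ hγ t => congrFun (isMIntegralCurve_Ioo_eq_of_contMDiff_boundaryless
    (t₀ := 0) (contMDiff_neg_grad g hf) hγ (hφ (γ 0)) (φ.map_zero_apply _).symm) t⟩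

namespace IsGradFlow

variable {φ : Flow ℝ M} (hφ : IsGradFlow g f φ)

include hφ

theorem reverse : IsGradFlow g (-f) φ.reverse where
  isFlowLine y := (hφ.isFlowLine y).comp_neg
  eq_of_isFlowLine γ hγ t := by
    have hrev := hφ.eq_of_isFlowLine _ (by simpa using hγ.comp_neg) (-t)
    simpa using hrev

theorem mem_stable_iff {p y : M} : y ∈ stable g f p ↔ Tendsto (fun t => φ t y) atTop (𝓝 p) := by
  refine ⟨?_, fun h => ⟨_, hφ.isFlowLine y, φ.map_zero_apply y, h⟩⟩
  rintro ⟨γ, hγ, rfl, hp⟩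
  exact hp.congr (hφ.eq_of_isFlowLine γ hγ)

theorem mem_unstable_iff {p y : M} :
    y ∈ unstable g f p ↔ Tendsto (fun t => φ t y) atBot (𝓝 p) := by
  rw [← stable_neg, hφ.reverse.mem_stable_iff, ← map_neg_atTop, tendsto_map'_iff]
  rfl

theorem apply_mem_stable_iff {p y : M} (s : ℝ) : φ s y ∈ stable g f p ↔ y ∈ stable g f p := by
  simp only [hφ.mem_stable_iff, ← φ.map_add]
  exact (tendsto_map'_iff (g := fun t => t + s) (x := atTop) (f := fun t => φ t y)).symm.trans
    (by rw [map_add_atTop_eq])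

theorem apply_of_isCriticalPoint {y : M} (hy : IsCriticalPoint (n := n) f y) (t : ℝ) :
    φ t y = y := by
  have hzero : -grad g f y = 0 := by rw [(grad_eq_zero_iff g f y).2 hy, neg_zero]
  exact (hφ.eq_of_isFlowLine (fun _ => y) (isMIntegralCurve_const (v := fun x => -grad g f x)
    hzero) t).symm

theorem not_isCriticalPoint_apply {y : M} (hy : ¬ IsCriticalPoint (n := n) f y) (t : ℝ) :
    ¬ IsCriticalPoint (n := n) f (φ t y) := fun h => hy <| by
  have hback := hφ.apply_of_isCriticalPoint h (-t)
  rw [← φ.map_add, neg_add_cancel, φ.map_zero_apply] at hback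
  rwa [hback]

theorem mem_stable_self {p : M} (hp : IsCriticalPoint (n := n) f p) : p ∈ stable g f p :=
  hφ.mem_stable_iff.2 <| tendsto_const_nhds.congr fun t => (hφ.apply_of_isCriticalPoint hp t).symm

theorem mem_unstable_self {p : M} (hp : IsCriticalPoint (n := n) f p) : p ∈ unstable g f p := by
  rw [← stable_neg]
  exact hφ.reverse.mem_stable_self (isCriticalPoint_neg_iff.2 hp)

theorem eq_of_mem_stable [T2Space M] {p y : M} (h : y ∈ stable g f p)
    (hy : IsCriticalPoint (n := n) f y) : y = p := by
  rw [hφ.mem_stable_iff, funext (hφ.apply_of_isCriticalPoint hy)] at h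
  exact tendsto_nhds_unique tendsto_const_nhds h

theorem tendsto_comp_of_mem_stable (hf : Continuous f) {p y : M} (h : y ∈ stable g f p) :
    Tendsto (fun t => f (φ t y)) atTop (𝓝 (f p)) :=
  (hf.tendsto p).comp (hφ.mem_stable_iff.1 h)

theorem hasDerivAt_comp (hf : MDifferentiable (𝓡 n) 𝓘(ℝ, ℝ) f) (y : M) (t : ℝ) :
    HasDerivAt (fun t => f (φ t y))
      (-g.inner (φ t y) (grad g f (φ t y)) (grad g f (φ t y))) t := by
  let L : EuclideanSpace ℝ (Fin n) →L[ℝ] ℝ := mfderiv (𝓡 n) 𝓘(ℝ, ℝ) f (φ t y)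
  let w : EuclideanSpace ℝ (Fin n) := -grad g f (φ t y)
  have hcomp : HasFDerivAt (fun t => f (φ t y)) (L.comp ((1 : ℝ →L[ℝ] ℝ).smulRight w)) t :=
    (HasMFDerivAt.comp t (hf (φ t y)).hasMFDerivAt (hφ.isFlowLine y t)).hasFDerivAt
  refine hcomp.hasDerivAt.congr_deriv ?_
  calc L ((1 : ℝ) • w) = L w := by rw [one_smul]
    _ = g.inner (φ t y) (grad g f (φ t y)) (-grad g f (φ t y)) := (inner_grad g f _ _).symm
    _ = _ := map_neg _ _

theorem antitone (hf : MDifferentiable (𝓡 n) 𝓘(ℝ, ℝ) f) (y : M) :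
    Antitone fun t => f (φ t y) := by
  refine antitone_of_hasDerivAt_nonpos (hφ.hasDerivAt_comp hf y) fun t => neg_nonpos.2 ?_
  by_cases h : grad g f (φ t y) = 0
  · rw [h]
    exact (map_zero _).ge
  · exact (g.pos _ _ h).le

theorem strictAnti (hf : MDifferentiable (𝓡 n) 𝓘(ℝ, ℝ) f) {y : M}
    (hy : ¬ IsCriticalPoint (n := n) f y) : StrictAnti fun t => f (φ t y) := by
  refine strictAnti_of_deriv_neg fun t => ?_
  rw [(hφ.hasDerivAt_comp hf y t).deriv, neg_lt_zero]
  exact g.pos _ _ fun h => hφ.not_isCriticalPoint_apply hy t ((grad_eq_zero_iff g f _).1 h)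

theorem apply_lt (hf : MDifferentiable (𝓡 n) 𝓘(ℝ, ℝ) f) {y : M}
    (hy : ¬ IsCriticalPoint (n := n) f y) {t : ℝ} (ht : 0 < t) : f (φ t y) < f y := by
  simpa using hφ.strictAnti hf hy ht

theorem apply_le (hf : MDifferentiable (𝓡 n) 𝓘(ℝ, ℝ) f) (y : M) {t : ℝ} (ht : 0 ≤ t) :
    f (φ t y) ≤ f y := by
  simpa using hφ.antitone hf y ht

theorem le_of_mem_stable (hf : MDifferentiable (𝓡 n) 𝓘(ℝ, ℝ) f) {p y : M}
    (h : y ∈ stable g f p) : f p ≤ f y := by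
  simpa using (hφ.antitone hf y).le_of_tendsto (hφ.tendsto_comp_of_mem_stable hf.continuous h) 0

theorem lt_of_mem_stable (hf : MDifferentiable (𝓡 n) 𝓘(ℝ, ℝ) f) {p y : M}
    (h : y ∈ stable g f p) (hy : ¬ IsCriticalPoint (n := n) f y) : f p < f y :=
  (hφ.le_of_mem_stable hf ((hφ.apply_mem_stable_iff 1).2 h)).trans_lt (hφ.apply_lt hf hy one_pos)

variable [CompactSpace M]

theorem mem_stable_of_mem_trappedSet (hf : MDifferentiable (𝓡 n) 𝓘(ℝ, ℝ) f) {K : Set M}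
    (hK : IsClosed K) {p y : M} (hp : ∀ z ∈ K, IsCriticalPoint (n := n) f z → z = p)
    (hy : y ∈ trappedSet φ K) : y ∈ stable g f p := by
  have hbdd : BddBelow (range fun t => f (φ t y)) :=
    (isCompact_range hf.continuous).bddBelow.mono (range_subset_iff.2 fun t => mem_range_self _)
  have hlim := tendsto_atTop_ciInf (hφ.antitone hf y) hbdd
  set L := ⨅ t, f (φ t y)
  have hcluster : ∀ (z : M) (u : ℝ → M), MapClusterPt z atTop u → Tendsto (f ∘ u) atTop (𝓝 L) →
      f z = L := fun z u hz hu => by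
    have hfz : MapClusterPt (f z) atTop (f ∘ u) := hz.continuousAt_comp hf.continuous.continuousAt
    exact eq_of_nhds_neBot (hfz.clusterPt.mono hu)
  refine hφ.mem_stable_iff.2 (hK.isCompact.tendsto_nhds_of_unique_mapClusterPt
    ((eventually_ge_atTop 0).mono hy) fun z hz hcl => hp z hz <| by_contra fun hne => ?_)
  have hstep : f (φ 1 z) = L := hcluster (φ 1 z) (φ 1 ∘ fun t => φ t y)
    (hcl.continuousAt_comp (φ.continuous continuous_const continuous_id).continuousAt)
    ((hlim.comp (tendsto_atTop_add_const_left atTop 1 tendsto_id)).congr fun t => by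
      simp [φ.map_add])
  exact (hφ.apply_lt hf hne one_pos).ne (hstep.trans (hcluster z _ hcl hlim).symm)

theorem exists_mem_trappedSet_of_lt (hf : MDifferentiable (𝓡 n) 𝓘(ℝ, ℝ) f) {p : M} {W : Set M}
    (hW : W ∈ 𝓝 p) (hfr : ∀ z ∈ frontier W, ¬ IsCriticalPoint (n := n) f z) :
    ∃ δ > 0, ∀ y ∈ stable g f p, f y < f p + δ → y ∈ trappedSet φ W := by
  have hcont : Continuous fun z => f z - f (φ 1 z) :=
    hf.continuous.sub (hf.continuous.comp (φ.continuous continuous_const continuous_id))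
  obtain ⟨δ, hδ, hdrop⟩ := (isClosed_frontier (s := W)).isCompact.exists_forall_le'
    hcont.continuousOn fun z hz => sub_pos.2 (hφ.apply_lt hf (hfr z hz) one_pos)
  refine ⟨δ, hδ, fun y hy hlt => mem_trappedSet_of_forall_notMem_frontier φ
    (fun t ht hmem => ?_) ?_⟩
  · have hle := hφ.le_of_mem_stable hf ((hφ.apply_mem_stable_iff 1).2
      ((hφ.apply_mem_stable_iff t).2 hy))
    linarith [hdrop _ hmem, hφ.apply_le hf y ht]
  · exact ((eventually_ge_atTop (0 : ℝ)).and ((hφ.mem_stable_iff.1 hy).eventually hW)).exists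

variable [T2Space M]

theorem stable_mem_nhds_self (hf : ContMDiff (𝓡 n) 𝓘(ℝ, ℝ) ∞ f) {q : M} (hq : IsLocalMin f q)
    (hd : (hessian (n := n) f q).det ≠ 0) : stable g f q ∈ 𝓝 q := by
  have hdiff : MDifferentiable (𝓡 n) 𝓘(ℝ, ℝ) f := hf.mdifferentiable (by simp)
  have hnear := (eventually_not_isCriticalPoint hf hd).and (eventually_lt_of_isLocalMin hf hd hq)
  obtain ⟨W, hW, hWc, hWV⟩ := exists_mem_nhds_isClosed_subset (eventually_nhdsWithin_iff.1 hnear)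
  obtain ⟨m, hm, hmin⟩ := (isClosed_frontier (s := W)).isCompact.exists_forall_le'
    hf.continuous.continuousOn fun z hz =>
      (hWV (hWc.frontier_subset hz) (ne_of_mem_frontier hW hz)).2
  filter_upwards [hW, hf.continuous.continuousAt.eventually (gt_mem_nhds hm)] with y hyW hym
  refine hφ.mem_stable_of_mem_trappedSet hdiff hWc
    (fun z hz hc => by_contra fun hne => (hWV hz hne).1 hc)
    (mem_trappedSet_of_forall_notMem_frontier φ (fun t ht hmem => ?_) ⟨0, le_rfl, by simpa⟩)
  linarith [hmin _ hmem, hφ.apply_le hdiff y ht]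

theorem stable_mem_nhds (hf : ContMDiff (𝓡 n) 𝓘(ℝ, ℝ) ∞ f) {q : M} (hq : IsLocalMin f q)
    (hd : (hessian (n := n) f q).det ≠ 0) {x : M} (hx : x ∈ stable g f q) :
    stable g f q ∈ 𝓝 x := by
  obtain ⟨t, ht⟩ := ((hφ.mem_stable_iff.1 hx).eventually
    (eventually_mem_nhds_iff.2 (hφ.stable_mem_nhds_self hf hq hd))).exists
  filter_upwards [(φ.continuous continuous_const continuous_id).continuousAt.preimage_mem_nhds ht]
    with y hy
  exact (hφ.apply_mem_stable_iff t).1 hy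

end IsGradFlow

end FlowLine

section SecondDerivativeTest

variable {E : Type*} [NormedAddCommGroup E] [NormedSpace ℝ E] {F : E → ℝ} {z₀ : E}

theorem isLocalMin_of_eventually_fderiv_apply_sub_nonneg
    (hF : ∀ᶠ z in 𝓝 z₀, DifferentiableAt ℝ F z ∧ 0 ≤ fderiv ℝ F z (z - z₀)) :
    IsLocalMin F z₀ := by
  obtain ⟨r, hr, hball⟩ := Metric.eventually_nhds_iff_ball.1 hF
  filter_upwards [Metric.ball_mem_nhds z₀ hr] with z hz
  have hseg : ∀ t ∈ Icc (0 : ℝ) 1, AffineMap.lineMap z₀ z t ∈ Metric.ball z₀ r := fun t ht =>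
    (convex_ball z₀ r).lineMap_mem (Metric.mem_ball_self hr) hz ht
  have hder : ∀ t ∈ Icc (0 : ℝ) 1, HasDerivAt (fun t : ℝ => F (AffineMap.lineMap z₀ z t))
      (fderiv ℝ F (AffineMap.lineMap z₀ z t) (z - z₀)) t := fun t ht =>
    (hball _ (hseg t ht)).1.hasFDerivAt.comp_hasDerivAt t AffineMap.hasDerivAt_lineMap
  have hmono : MonotoneOn (fun t : ℝ => F (AffineMap.lineMap z₀ z t)) (Icc 0 1) := by
    refine monotoneOn_of_deriv_nonneg (convex_Icc 0 1)
      (fun t ht => (hder t ht).continuousAt.continuousWithinAt)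
      (fun t ht => (hder t (interior_subset ht)).differentiableAt.differentiableWithinAt)
      fun t ht => ?_
    have hnonneg := (hball _ (hseg t (interior_subset ht))).2
    rw [(hder t (interior_subset ht)).deriv]
    rw [interior_Icc] at ht
    rw [AffineMap.lineMap_apply, vadd_eq_add, add_sub_cancel_right, vsub_eq_sub, map_smul,
      smul_eq_mul] at hnonneg
    rw [AffineMap.lineMap_apply, vadd_eq_add, vsub_eq_sub]
    exact nonneg_of_mul_nonneg_right hnonneg ht.1
  simpa using hmono ⟨le_rfl, zero_le_one⟩ ⟨zero_le_one, le_rfl⟩ zero_le_one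

theorem isLocalMin_of_isCoercive {B : E →L[ℝ] E →L[ℝ] ℝ}
    (hF : ∀ᶠ z in 𝓝 z₀, DifferentiableAt ℝ F z) (h0 : fderiv ℝ F z₀ = 0)
    (hB : HasFDerivAt (fderiv ℝ F) B z₀) (hpos : IsCoercive B) : IsLocalMin F z₀ := by
  obtain ⟨c, hc, hB_ge⟩ := hpos
  refine isLocalMin_of_eventually_fderiv_apply_sub_nonneg ?_
  filter_upwards [hF, hB.isLittleO.def hc] with z hz hlin
  refine ⟨hz, ?_⟩
  rw [h0, sub_zero] at hlin
  have herr := (fderiv ℝ F z - B (z - z₀)).le_of_opNorm_le hlin (z - z₀)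
  rw [sub_apply, Real.norm_eq_abs] at herr
  linarith [neg_abs_le (fderiv ℝ F z (z - z₀) - B (z - z₀) (z - z₀)), hB_ge (z - z₀)]

theorem isCoercive_of_pos [FiniteDimensional ℝ E] {B : E →L[ℝ] E →L[ℝ] ℝ}
    (hB : ∀ a ≠ 0, 0 < B a a) : IsCoercive B := by
  obtain ⟨c, hc, hmin⟩ := (isCompact_sphere (0 : E) 1).exists_forall_le'
    (f := fun a => B a a) (by fun_prop) fun a ha => hB a (ne_zero_of_mem_unit_sphere ⟨a, ha⟩)
  refine ⟨c, hc, fun a => ?_⟩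
  rcases eq_or_ne a 0 with rfl | ha
  · simp
  have hunit := hmin (‖a‖⁻¹ • a) (by simp [norm_smul, ha])
  simp only [map_smul, smul_apply, smul_eq_mul] at hunit
  have hna : ‖a‖ ≠ 0 := norm_ne_zero_iff.2 ha
  calc c * ‖a‖ * ‖a‖ ≤ (‖a‖⁻¹ * (‖a‖⁻¹ * B a a)) * ‖a‖ * ‖a‖ := by gcongr
    _ = B a a := by field_simp

end SecondDerivativeTest

section Diagonalization

variable {E : Type*} [AddCommGroup E] [Module ℝ E]

theorem exists_eigenbasis_of_symmetric [FiniteDimensional ℝ E] {m : ℕ}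
    (hm : Module.finrank ℝ E = m) (G : LinearMap.BilinForm ℝ E) (hpos : ∀ a ≠ 0, 0 < G a a)
    (hsymm : ∀ a b, G a b = G b a) {A : E →ₗ[ℝ] E} (hA : ∀ a b, G (A a) b = G a (A b)) :
    ∃ (b : Module.Basis (Fin m) ℝ E) (μ : Fin m → ℝ), (∀ i, A (b i) = μ i • b i) ∧
      ∀ a, G (A a) a = ∑ i, μ i * b.repr a i ^ 2 := by
  let core : InnerProductSpace.Core ℝ E :=
    { inner := fun a b => G a b
      conj_inner_symm := fun a b => hsymm b a
      re_inner_nonneg := fun a => by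
        rcases eq_or_ne a 0 with rfl | ha
        · simp
        · exact (hpos a ha).le
      add_left := fun a b c => by simp
      smul_left := fun a b r => by simp
      definite := fun a h => by_contra fun ha => (hpos a ha).ne' h }
  let _ : NormedAddCommGroup E := core.toNormedAddCommGroup
  let _ : InnerProductSpace ℝ E := InnerProductSpace.ofCore core.toCore
  have hAsymm : A.IsSymmetric := hA
  let b := hAsymm.eigenvectorBasis hm
  have heig : ∀ i, A (b i) = hAsymm.eigenvalues hm i • b i := hAsymm.apply_eigenvectorBasis hm
  refine ⟨b.toBasis, hAsymm.eigenvalues hm, fun i => by simpa using heig i, fun a => ?_⟩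
  calc G (A a) a = ∑ i, inner ℝ (A a) (b i) * inner ℝ (b i) a := (b.sum_inner_mul_inner _ _).symm
    _ = ∑ i, hAsymm.eigenvalues hm i * b.toBasis.repr a i ^ 2 := Finset.sum_congr rfl fun i _ => by
      rw [hAsymm a (b i), heig, inner_smul_right, real_inner_comm, b.coe_toBasis_repr_apply,
        b.repr_apply_apply]
      ring

theorem coord_apply_of_eigenbasis {ι : Type*} (b : Module.Basis ι ℝ E) {μ : ι → ℝ}
    {A : E →ₗ[ℝ] E} (hb : ∀ i, A (b i) = μ i • b i) (i : ι) (a : E) :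
    b.coord i (A a) = μ i * b.coord i a := by
  have hcomp : b.coord i ∘ₗ A = μ i • b.coord i := b.ext fun j => by
    rcases eq_or_ne j i with rfl | hne
    · simp [hb]
    · simp [hb, hne]
  exact LinearMap.congr_fun hcomp a

end Diagonalization

/-- A splitting of a plane into a contracting line and an expanding line of a linear map `A`, with
eigenvectors `es` and `eu`, eigenvalues `-lam < 0` and `mu > 0`, and coordinate functions `s`, `u`
along the two lines. -/
structure SaddleFrame {E : Type*} [NormedAddCommGroup E] [NormedSpace ℝ E] (A : E →L[ℝ] E) where
  (lam mu : ℝ)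
  (es eu : E)
  (s u : E →L[ℝ] ℝ)
  lam_pos : 0 < lam
  mu_pos : 0 < mu
  s_es : s es = 1
  s_eu : s eu = 0
  u_es : u es = 0
  u_eu : u eu = 1
  decomp : ∀ z, s z • es + u z • eu = z
  s_map : ∀ z, s (A z) = -lam * s z
  u_map : ∀ z, u (A z) = mu * u z

namespace SaddleFrame

variable {E : Type*} [NormedAddCommGroup E] [NormedSpace ℝ E] {A : E →L[ℝ] E}

/-- The frame of `A` given by a basis of two eigenvectors, with eigenvalues of opposite signs. -/
def ofEigenbasis [FiniteDimensional ℝ E] (b : Module.Basis (Fin 2) ℝ E) {μ : Fin 2 → ℝ}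
    (hb : ∀ i, A (b i) = μ i • b i) {i j : Fin 2} (hi : μ i < 0) (hj : 0 < μ j) :
    SaddleFrame A :=
  have hij : i ≠ j := fun h => (h ▸ hi).not_gt hj
  { lam := -μ i
    mu := μ j
    es := b i
    eu := b j
    s := (b.coord i).toContinuousLinearMap
    u := (b.coord j).toContinuousLinearMap
    lam_pos := neg_pos.2 hi
    mu_pos := hj
    s_es := by simp
    s_eu := by simp [hij.symm]
    u_es := by simp [hij]
    u_eu := by simp
    decomp := fun z =>
      (Fintype.sum_eq_add (f := fun k => b.coord k z • b k) i j hij (by lia)).symm.trans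
        (b.sum_repr z)
    s_map := fun z => by
      rw [neg_neg]
      exact coord_apply_of_eigenbasis b hb i z
    u_map := coord_apply_of_eigenbasis b hb j }

/-- The frame of `-A`, in which the contracting and the expanding line are exchanged. -/
def neg (S : SaddleFrame A) : SaddleFrame (-A) where
  lam := S.mu
  mu := S.lam
  es := S.eu
  eu := S.es
  s := S.u
  u := S.s
  lam_pos := S.mu_pos
  mu_pos := S.lam_pos
  s_es := S.u_eu
  s_eu := S.u_es
  u_es := S.s_eu
  u_eu := S.s_es
  decomp z := by rw [add_comm, S.decomp]
  s_map z := by simp [S.u_map]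
  u_map z := by simp [S.s_map]

/-- The frame with the contracting eigenvector reversed. -/
def flip (S : SaddleFrame A) : SaddleFrame A where
  lam := S.lam
  mu := S.mu
  es := -S.es
  eu := S.eu
  s := -S.s
  u := S.u
  lam_pos := S.lam_pos
  mu_pos := S.mu_pos
  s_es := by simp [S.s_es]
  s_eu := by simp [S.s_eu]
  u_es := by simp [S.u_es]
  u_eu := S.u_eu
  decomp z := by simp [S.decomp]
  s_map z := by simp [S.s_map]
  u_map := S.u_map

theorem eq_of_coords (S : SaddleFrame A) {z w : E} (hs : S.s z = S.s w) (hu : S.u z = S.u w) :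
    z = w := by
  rw [← S.decomp z, ← S.decomp w, hs, hu]

theorem isBigO_norm_coords (S : SaddleFrame A) {α : Type*} (l : Filter α) (h : α → E) :
    h =O[l] fun x => |S.s (h x)| + |S.u (h x)| := by
  refine Asymptotics.IsBigO.of_bound (max ‖S.es‖ ‖S.eu‖) (Eventually.of_forall fun x => ?_)
  calc ‖h x‖ = ‖S.s (h x) • S.es + S.u (h x) • S.eu‖ := by rw [S.decomp]
    _ ≤ |S.s (h x)| * ‖S.es‖ + |S.u (h x)| * ‖S.eu‖ := by
      exact (norm_add_le _ _).trans_eq (by simp only [norm_smul, Real.norm_eq_abs])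
    _ ≤ |S.s (h x)| * max ‖S.es‖ ‖S.eu‖ + |S.u (h x)| * max ‖S.es‖ ‖S.eu‖ := by
      gcongr
      exacts [le_max_left _ _, le_max_right _ _]
    _ = max ‖S.es‖ ‖S.eu‖ * ‖|S.s (h x)| + |S.u (h x)|‖ := by
      rw [Real.norm_of_nonneg (by positivity)]
      ring

theorem eventually_abs_apply_sub_le (S : SaddleFrame A) {X : E → E} {z₀ : E}
    (hX : HasStrictFDerivAt X A z₀) (ℓ : E →L[ℝ] ℝ) {η : ℝ} (hη : 0 < η) :
    ∀ᶠ q in 𝓝 z₀ ×ˢ 𝓝 z₀, |ℓ (X q.1 - X q.2 - A (q.1 - q.2))| ≤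
      η * (|S.s (q.1 - q.2)| + |S.u (q.1 - q.2)|) := by
  rw [← nhds_prod_eq]
  have hℓ : (fun q : E × E => ℓ (X q.1 - X q.2 - A (q.1 - q.2))) =O[𝓝 (z₀, z₀)]
      fun q => X q.1 - X q.2 - A (q.1 - q.2) := ℓ.isBigO_comp _ _
  have hlittle := (hℓ.trans_isLittleO hX.isLittleO).trans_isBigO (S.isBigO_norm_coords _ _)
  filter_upwards [hlittle.def hη] with q hq
  rwa [Real.norm_eq_abs, Real.norm_of_nonneg (by positivity)] at hq

/-- Differences of values of the vector field `X` on `U` are, in each coordinate, `η`-close to those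
of the linear map `A`. -/
def IsCloseOn (S : SaddleFrame A) (X : E → E) (η : ℝ) (U : Set E) : Prop :=
  ∀ z ∈ U, ∀ w ∈ U,
    |S.s (X z - X w) + S.lam * S.s (z - w)| ≤ η * (|S.s (z - w)| + |S.u (z - w)|) ∧
    |S.u (X z - X w) - S.mu * S.u (z - w)| ≤ η * (|S.s (z - w)| + |S.u (z - w)|)

theorem exists_isCloseOn (S : SaddleFrame A) {X : E → E} {z₀ : E}
    (hX : HasStrictFDerivAt X A z₀) {η : ℝ} (hη : 0 < η) :
    ∃ U ∈ 𝓝 z₀, S.IsCloseOn X η U := by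
  refine eventually_prod_self_iff.1 (?_ : ∀ᶠ q in 𝓝 z₀ ×ˢ 𝓝 z₀,
    |S.s (X q.1 - X q.2) + S.lam * S.s (q.1 - q.2)| ≤
      η * (|S.s (q.1 - q.2)| + |S.u (q.1 - q.2)|) ∧
    |S.u (X q.1 - X q.2) - S.mu * S.u (q.1 - q.2)| ≤
      η * (|S.s (q.1 - q.2)| + |S.u (q.1 - q.2)|))
  filter_upwards [S.eventually_abs_apply_sub_le hX S.s hη,
    S.eventually_abs_apply_sub_le hX S.u hη] with q hs hu
  rw [map_sub S.s (X q.1 - X q.2), S.s_map, neg_mul, sub_neg_eq_add] at hs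
  rw [map_sub S.u (X q.1 - X q.2), S.u_map] at hu
  exact ⟨hs, hu⟩

end SaddleFrame

section SaddlePoint

variable {n : ℕ} {M : Type*} [TopologicalSpace M] [ChartedSpace (EuclideanSpace ℝ (Fin n)) M]
  [IsManifold (𝓡 n) ∞ M] {f : M → ℝ} {p : M}

theorem isLocalMin_of_chartHessian_pos (hf : ContMDiff (𝓡 n) 𝓘(ℝ, ℝ) ∞ f)
    (hp : IsCriticalPoint (n := n) f p) (hpos : ∀ a ≠ 0, 0 < chartHessian (n := n) f p a a) :
    IsLocalMin f p := by
  have hsmooth := contDiffAt_comp_extChartAt_symm (hf p)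
  have hzero : fderiv ℝ (f ∘ (extChartAt (𝓡 n) p).symm) (extChartAt (𝓡 n) p p) = 0 := by
    rw [IsCriticalPoint, (hf.mdifferentiable (by simp) p).mfderiv, ModelWithCorners.range_eq_univ,
      fderivWithin_univ] at hp
    exact hp
  have hmin : IsLocalMin (f ∘ (extChartAt (𝓡 n) p).symm) (extChartAt (𝓡 n) p p) :=
    isLocalMin_of_isCoercive (((hsmooth.of_le (m := 1) (by simp)).eventually (by simp)).mono
      fun z hz => hz.differentiableAt (by simp)) hzero (hasFDerivAt_fderiv_chart (hf p))
      (isCoercive_of_pos hpos)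
  have hback := (continuousAt_extChartAt (I := 𝓡 n) p).eventually hmin
  filter_upwards [hback, extChartAt_source_mem_nhds (I := 𝓡 n) p] with y hy hys
  simpa only [Function.comp_apply, (extChartAt (𝓡 n) p).left_inv hys, extChartAt_to_inv] using hy

theorem exists_eigenbasis_linearization (g : Metric n M) (hf : ContMDiff (𝓡 n) 𝓘(ℝ, ℝ) ∞ f)
    (hp : IsCriticalPoint (n := n) f p) :
    ∃ (b : Module.Basis (Fin n) ℝ (EuclideanSpace ℝ (Fin n))) (μ : Fin n → ℝ),
      (∀ i, linearization g f p (b i) = μ i • b i) ∧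
      ∀ a, chartHessian f p a a = -∑ i, μ i * b.repr a i ^ 2 := by
  set G := chartMetric g p (extChartAt (𝓡 n) p p)
  have hlin : ∀ a, G (linearization g f p a) = -chartHessian f p a :=
    chartMetric_linearization g hf hp
  have hG : ∀ a b, G a b = G b a := chartMetric_symm g p _
  obtain ⟨b, μ, hb, hdiag⟩ := exists_eigenbasis_of_symmetric finrank_euclideanSpace_fin
    G.toLinearMap₁₂ (fun a ha => chartMetric_pos g (mem_extChartAt_target p) ha) hG
    (A := (linearization g f p).toLinearMap) fun a b => by
      change G (linearization g f p a) b = G a (linearization g f p b)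
      rw [hG a, hlin, hlin, neg_apply, neg_apply, chartHessian_symm (hf p)]
  refine ⟨b, μ, hb, fun a => ?_⟩
  rw [← hdiag]
  change chartHessian f p a a = -G (linearization g f p a) a
  rw [hlin, neg_apply, neg_neg]

theorem isLocalMin_of_forall_pos {ι : Type*} [Fintype ι]
    (hf : ContMDiff (𝓡 n) 𝓘(ℝ, ℝ) ∞ f) (hp : IsCriticalPoint (n := n) f p)
    (b : Module.Basis ι ℝ (EuclideanSpace ℝ (Fin n))) {ν : ι → ℝ}
    (hdiag : ∀ a, chartHessian (n := n) f p a a = ∑ i, ν i * b.repr a i ^ 2)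
    (hν : ∀ i, 0 < ν i) : IsLocalMin f p := by
  refine isLocalMin_of_chartHessian_pos hf hp fun a ha => ?_
  obtain ⟨i, hi⟩ : ∃ i, b.repr a i ≠ 0 := by
    by_contra! h
    exact ha (b.repr.map_eq_zero_iff.1 (Finsupp.ext h))
  rw [hdiag]
  exact Finset.sum_pos' (fun j _ => mul_nonneg (hν j).le (sq_nonneg _))
    ⟨i, Finset.mem_univ i, mul_pos (hν i) (sq_pos_of_ne_zero hi)⟩

theorem eigenvalue_linearization_ne_zero (g : Metric n M) (hf : ContMDiff (𝓡 n) 𝓘(ℝ, ℝ) ∞ f)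
    (hp : IsCriticalPoint (n := n) f p) (hd : (hessian (n := n) f p).det ≠ 0) {μ : ℝ}
    {a : EuclideanSpace ℝ (Fin n)} (ha : a ≠ 0) (hμ : linearization g f p a = μ • a) :
    μ ≠ 0 := by
  rintro rfl
  refine ha (eq_zero_of_chartHessian_eq_zero hd (neg_eq_zero.1 ?_))
  rw [← chartMetric_linearization g hf hp, hμ, zero_smul, map_zero]

end SaddlePoint

section Surface

variable {M : Type*} [TopologicalSpace M] [ChartedSpace (EuclideanSpace ℝ (Fin 2)) M]
  [IsManifold (𝓡 2) ∞ M] {f : M → ℝ} {p : M}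

theorem IsSaddle.nonempty_saddleFrame (g : Metric 2 M) (hf : ContMDiff (𝓡 2) 𝓘(ℝ, ℝ) ∞ f)
    (hp : IsSaddle 2 f p) (hd : (hessian (n := 2) f p).det ≠ 0) :
    Nonempty (SaddleFrame (linearization g f p)) := by
  obtain ⟨hcrit, hextr⟩ := hp
  obtain ⟨b, μ, hb, hdiag⟩ := exists_eigenbasis_linearization g hf hcrit
  have hμ : ∀ i, μ i ≠ 0 := fun i =>
    eigenvalue_linearization_ne_zero g hf hcrit hd (b.ne_zero i) (hb i)
  obtain ⟨i, hi⟩ : ∃ i, μ i < 0 := by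
    by_contra! hpos
    have hmin : IsLocalMin (-f) p :=
      isLocalMin_of_forall_pos hf.neg (isCriticalPoint_neg_iff.2 hcrit) b
        (fun a => by rw [chartHessian_neg, neg_apply, neg_apply, hdiag, neg_neg])
        fun i => (hpos i).lt_of_ne' (hμ i)
    exact hextr (Or.inr (hmin.mono fun y hy => neg_le_neg_iff.1 hy))
  obtain ⟨j, hj⟩ : ∃ j, 0 < μ j := by
    by_contra! hneg
    refine hextr (Or.inl (isLocalMin_of_forall_pos hf hcrit b (ν := fun i => -μ i) (fun a => ?_)
      fun i => neg_pos.2 ((hneg i).lt_of_ne (hμ i))))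
    simp only [hdiag, neg_mul, Finset.sum_neg_distrib]
  exact ⟨SaddleFrame.ofEigenbasis b hb hi hj⟩

end Surface

theorem nonpos_of_mul_le_deriv {q q' : ℝ → ℝ} {c B : ℝ} (hc : 0 < c)
    (hq : ∀ t, 0 ≤ t → HasDerivAt q (q' t) t) (hle : ∀ t, 0 ≤ t → c * q t ≤ q' t)
    (hB : ∀ t, 0 ≤ t → q t ≤ B) : q 0 ≤ 0 := by
  have hder : ∀ t, 0 ≤ t → HasDerivAt (fun t => Real.exp (-c * t) * q t)
      (Real.exp (-c * t) * (q' t - c * q t)) t := fun t ht => by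
    refine (((hasDerivAt_id t).const_mul (-c)).exp.mul (hq t ht)).congr_deriv ?_
    simp only [id]
    ring
  have hmono : MonotoneOn (fun t => Real.exp (-c * t) * q t) (Ici 0) := by
    refine monotoneOn_of_deriv_nonneg (convex_Ici 0)
      (fun t ht => (hder t ht).continuousAt.continuousWithinAt)
      (fun t ht => (hder t (interior_subset ht)).differentiableAt.differentiableWithinAt)
      fun t ht => ?_
    rw [(hder t (interior_subset ht)).deriv]
    exact mul_nonneg (Real.exp_nonneg _) (sub_nonneg.2 (hle t (interior_subset ht)))
  have hlim : Tendsto (fun t => Real.exp (-c * t) * B) atTop (𝓝 0) := by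
    simpa using (Real.tendsto_exp_atBot.comp
      (tendsto_id.const_mul_atTop_of_neg (neg_neg_of_pos hc))).mul_const B
  refine ge_of_tendsto hlim ?_
  filter_upwards [eventually_ge_atTop 0] with t ht
  calc q 0 = Real.exp (-c * 0) * q 0 := by simp
    _ ≤ Real.exp (-c * t) * q t := hmono (mem_Ici.2 le_rfl) ht ht
    _ ≤ Real.exp (-c * t) * B := by
      gcongr
      exact hB t ht

theorem mul_sq_sub_sq_le_of_abs_le {lam mu a b p q : ℝ} (hlam : 0 ≤ lam) (hmu : 0 ≤ mu)
    (hp : |p + lam * a| ≤ mu / 4 * (|a| + |b|)) (hq : |q - mu * b| ≤ mu / 4 * (|a| + |b|)) :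
    mu * (b ^ 2 - a ^ 2) ≤ 2 * b * q - 2 * a * p := by
  have hpa : (p + lam * a) * a ≤ mu / 4 * (|a| + |b|) * |a| :=
    (le_abs_self _).trans (by rw [abs_mul]; gcongr)
  have hqb : -((q - mu * b) * b) ≤ mu / 4 * (|a| + |b|) * |b| :=
    (neg_le_abs _).trans (by rw [abs_mul]; gcongr)
  have hsum : (|a| + |b|) ^ 2 ≤ 2 * (a ^ 2 + b ^ 2) := by
    simpa only [sq_abs] using add_sq_le (a := |a|) (b := |b|)
  have hlam_sq : 0 ≤ lam * a ^ 2 := by positivity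
  linarith [mul_le_mul_of_nonneg_left hsum hmu]

-- The quadratic form `u ^ 2 - s ^ 2` of the difference of the two curves grows exponentially once
-- it is positive.
theorem SaddleFrame.IsCloseOn.eq_of_s_eq {E : Type*} [NormedAddCommGroup E] [NormedSpace ℝ E]
    {A : E →L[ℝ] E} {S : SaddleFrame A} {X : E → E} {U : Set E} (h : S.IsCloseOn X (S.mu / 4) U)
    (hU : Bornology.IsBounded U) {z w : ℝ → E} (hz : ∀ t, 0 ≤ t → HasDerivAt z (X (z t)) t)
    (hw : ∀ t, 0 ≤ t → HasDerivAt w (X (w t)) t) (hzU : ∀ t, 0 ≤ t → z t ∈ U)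
    (hwU : ∀ t, 0 ≤ t → w t ∈ U) (hs : S.s (z 0) = S.s (w 0)) : z 0 = w 0 := by
  have hcoord : ∀ (ℓ : E →L[ℝ] ℝ) (t : ℝ), 0 ≤ t → HasDerivAt (fun t => ℓ (z t - w t) ^ 2)
      (2 * ℓ (z t - w t) * ℓ (X (z t) - X (w t))) t := fun ℓ t ht =>
    ((ℓ.hasFDerivAt.comp_hasDerivAt t ((hz t ht).sub (hw t ht))).pow 2).congr_deriv
      (by rw [Nat.cast_two, pow_one]; rfl)
  obtain ⟨B, hB⟩ := (hU.sub hU).exists_norm_le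
  have hform : S.u (z 0 - w 0) ^ 2 - S.s (z 0 - w 0) ^ 2 ≤ 0 := by
    refine nonpos_of_mul_le_deriv S.mu_pos (B := (‖S.u‖ * B) ^ 2)
      (fun t ht => (hcoord S.u t ht).sub (hcoord S.s t ht)) (fun t ht => ?_) fun t ht => ?_
    · obtain ⟨hs', hu'⟩ := h _ (hzU t ht) _ (hwU t ht)
      exact mul_sq_sub_sq_le_of_abs_le S.lam_pos.le S.mu_pos.le hs' hu'
    · have hu : |S.u (z t - w t)| ≤ ‖S.u‖ * B :=
        S.u.le_opNorm_of_le (hB _ (sub_mem_sub (hzU t ht) (hwU t ht)))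
      exact (sub_le_self _ (sq_nonneg _)).trans (sq_le_sq.2 (hu.trans (le_abs_self _)))
  rw [map_sub S.s, hs, sub_self, zero_pow two_ne_zero, sub_zero, map_sub] at hform
  exact S.eq_of_coords hs (sub_eq_zero.1 (pow_eq_zero_iff two_ne_zero |>.1
    (le_antisymm hform (sq_nonneg _))))

theorem exists_nonneg_apply_eq {a b : ℝ → ℝ} {c : ℝ} (ha : ContinuousOn a (Ici 0))
    (hb : ContinuousOn b (Ici 0)) (hac : Tendsto a atTop (𝓝 c)) (hbc : Tendsto b atTop (𝓝 c))
    (h : 0 < (a 0 - c) * (b 0 - c)) : ∃ s, 0 ≤ s ∧ ∃ t, 0 ≤ t ∧ a s = b t := by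
  have hinf : (atTop : Filter ℝ) ≤ 𝓟 (Ici 0) := le_principal_iff.2 (Ici_mem_atTop 0)
  have h0 : (0 : ℝ) ∈ Ici 0 := mem_Ici.2 le_rfl
  rcases mul_pos_iff.1 h with ⟨hac', hbc'⟩ | ⟨hac', hbc'⟩
  · have hmin : c < min (a 0) (b 0) := lt_min (sub_pos.1 hac') (sub_pos.1 hbc')
    obtain ⟨s, hs, has⟩ := isPreconnected_Ici.intermediate_value_Ioc h0 hinf ha hac
      ⟨hmin, min_le_left _ _⟩
    obtain ⟨t, ht, hbt⟩ := isPreconnected_Ici.intermediate_value_Ioc h0 hinf hb hbc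
      ⟨hmin, min_le_right _ _⟩
    exact ⟨s, hs, t, ht, has.trans hbt.symm⟩
  · have hmax : max (a 0) (b 0) < c := max_lt (sub_neg.1 hac') (sub_neg.1 hbc')
    obtain ⟨s, hs, has⟩ := isPreconnected_Ici.intermediate_value_Ico h0 hinf ha hac
      ⟨le_max_left _ _, hmax⟩
    obtain ⟨t, ht, hbt⟩ := isPreconnected_Ici.intermediate_value_Ico h0 hinf hb hbc
      ⟨le_max_right _ _, hmax⟩
    exact ⟨s, hs, t, ht, has.trans hbt.symm⟩

theorem tendsto_of_strictAnti_comp {α β γ : Type*} [LinearOrder α] [TopologicalSpace α]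
    [OrderTopology α] [LinearOrder β] [TopologicalSpace β] [OrderClosedTopology β] {h : α → β}
    (hh : StrictAnti h) {l : Filter γ} {τ : γ → α} {a : α}
    (hτ : Tendsto (fun t => h (τ t)) l (𝓝 (h a))) : Tendsto τ l (𝓝 a) :=
  tendsto_order.2 ⟨fun _ hb => (hτ.eventually_lt_const (hh hb)).mono fun _ => hh.lt_iff_gt.1,
    fun _ hb => (hτ.eventually_const_lt (hh hb)).mono fun _ => hh.lt_iff_gt.1⟩

theorem mem_span_singleton_of_hasDerivAt_comp {E : Type*} [NormedAddCommGroup E] [NormedSpace ℝ E]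
    {F : ℝ → E} {τ : ℝ → ℝ} {a b : ℝ} {v w : E} (hF : HasDerivAt F w b) (hw : w ≠ 0)
    (hτ : ContinuousAt τ a) (hab : τ a = b) (h : HasDerivAt (fun t => F (τ t)) v a) :
    v ∈ Submodule.span ℝ {w} := by
  subst hab
  have hτO : (fun t => τ t - τ a) =O[𝓝 a] fun t => t - a :=
    ((hF.isTheta_sub hw).isBigO_symm.comp_tendsto
      (Tendsto.prodMk hτ (tendsto_pure.2 (Eventually.of_forall fun _ => rfl)))).trans h.isBigO_sub
  have herr := (hF.isLittleO.comp_tendsto hτ).trans_isBigO hτO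
  have hlin : HasDerivAt (fun t => (τ t - τ a) • w) v a := by
    rw [hasDerivAt_iff_isLittleO] at h ⊢
    refine (h.sub herr).congr_left fun t => ?_
    simp only [Function.comp_apply, sub_self, zero_smul]
    abel
  refine (Submodule.closed_of_finiteDimensional _).mem_of_tendsto
    (hasDerivAt_iff_tendsto_slope.1 hlin) (Eventually.of_forall fun t => ?_)
  rw [SetLike.mem_coe, slope_def_module, ← sub_smul, Submodule.mem_span_singleton]
  exact ⟨_, mul_smul _ _ _⟩

section TrappedSet

variable {X : Type*} [TopologicalSpace X]

theorem exists_apply_eq_of_injOn_trappedSet (φ : Flow ℝ X) {W : Set X} {σ : X → ℝ} {p x y : X}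
    (hσ : ContinuousOn σ W) (hinj : InjOn σ (trappedSet φ W)) (hσp : ContinuousAt σ p)
    (hx : x ∈ trappedSet φ W) (hy : y ∈ trappedSet φ W) (hxp : Tendsto (fun t => φ t x) atTop (𝓝 p))
    (hyp : Tendsto (fun t => φ t y) atTop (𝓝 p)) (hxy : 0 < (σ x - σ p) * (σ y - σ p)) :
    ∃ t, φ t x = y := by
  have hcont : ∀ z ∈ trappedSet φ W, ContinuousOn (fun t => σ (φ t z)) (Ici 0) := fun z hz =>
    hσ.comp (φ.continuous continuous_id continuous_const).continuousOn hz
  obtain ⟨s, hs, t, ht, hst⟩ := exists_nonneg_apply_eq (hcont x hx) (hcont y hy)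
    (hσp.tendsto.comp hxp) (hσp.tendsto.comp hyp) (by simpa using hxy)
  have heq := hinj (apply_mem_trappedSet hx hs) (apply_mem_trappedSet hy ht) hst
  exact ⟨-t + s, by rw [φ.map_add, heq, ← φ.map_add, neg_add_cancel, φ.map_zero_apply]⟩

end TrappedSet

namespace IsGradFlow

variable {n : ℕ} {M : Type*} [TopologicalSpace M] [ChartedSpace (EuclideanSpace ℝ (Fin n)) M]
  [IsManifold (𝓡 n) ∞ M] {g : Metric n M} {f : M → ℝ} {φ : Flow ℝ M} (hφ : IsGradFlow g f φ)

include hφ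

theorem hasDerivAt_chart {x y : M} {t : ℝ} (h : φ t y ∈ (extChartAt (𝓡 n) x).source) :
    HasDerivAt (fun t => extChartAt (𝓡 n) x (φ t y))
      (chartField g f x (extChartAt (𝓡 n) x (φ t y))) t :=
  hasDerivAt_chart_of_isMIntegralCurve (hφ.isFlowLine y) h

theorem exists_injOn_trappedSet (hf : ContMDiff (𝓡 n) 𝓘(ℝ, ℝ) ∞ f) {p : M}
    (S : SaddleFrame (linearization g f p)) :
    ∃ W ∈ 𝓝 p, W ⊆ (extChartAt (𝓡 n) p).source ∧
      InjOn (fun y => S.s (extChartAt (𝓡 n) p y)) (trappedSet φ W) := by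
  obtain ⟨U, hU, hclose⟩ := S.exists_isCloseOn (hasStrictFDerivAt_chartField g hf p)
    (div_pos S.mu_pos four_pos)
  set V := U ∩ Metric.ball (extChartAt (𝓡 n) p p) 1
  have hVc : S.IsCloseOn (chartField g f p) (S.mu / 4) V :=
    fun z hz w hw => hclose z hz.1 w hw.1
  refine ⟨(extChartAt (𝓡 n) p).source ∩ extChartAt (𝓡 n) p ⁻¹' V,
    inter_mem (extChartAt_source_mem_nhds p) ((continuousAt_extChartAt p).preimage_mem_nhds
      (inter_mem hU (Metric.ball_mem_nhds _ one_pos))), inter_subset_left, fun y hy z hz hyz => ?_⟩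
  have heq := hVc.eq_of_s_eq (Metric.isBounded_ball.subset inter_subset_right)
    (fun t ht => hφ.hasDerivAt_chart (hy t ht).1) (fun t ht => hφ.hasDerivAt_chart (hz t ht).1)
    (fun t ht => (hy t ht).2) (fun t ht => (hz t ht).2) (by simpa using hyz)
  simp only [φ.map_zero_apply] at heq
  exact (extChartAt (𝓡 n) p).injOn (trappedSet_subset φ _ hy).1 (trappedSet_subset φ _ hz).1 heq

theorem eventually_mem_orbit [T2Space M] [CompactSpace M] (hf : ContMDiff (𝓡 n) 𝓘(ℝ, ℝ) ∞ f)
    {p x : M} (hp : IsCriticalPoint (n := n) f p) (hd : (hessian (n := n) f p).det ≠ 0)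
    (S : SaddleFrame (linearization g f p)) (hx : x ∈ stable g f p)
    (hxc : ¬ IsCriticalPoint (n := n) f x) :
    ∀ᶠ y in 𝓝 x, y ∈ stable g f p → y ∈ φ.orbit x := by
  have hdiff : MDifferentiable (𝓡 n) 𝓘(ℝ, ℝ) f := hf.mdifferentiable (by simp)
  obtain ⟨W₀, hW₀, hsource, hinj⟩ := hφ.exists_injOn_trappedSet hf S
  obtain ⟨W, hW, hWc, hWV⟩ := exists_mem_nhds_isClosed_subset
    (inter_mem hW₀ (eventually_nhdsWithin_iff.1 (eventually_not_isCriticalPoint hf hd)))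
  obtain ⟨δ, hδ, htrap⟩ := hφ.exists_mem_trappedSet_of_lt hdiff hW fun z hz =>
    (hWV (hWc.frontier_subset hz)).2 (ne_of_mem_frontier hW hz)
  have hWinj := hinj.mono (trappedSet_mono φ (hWV.trans inter_subset_left))
  set σ : M → ℝ := fun y => S.s (extChartAt (𝓡 n) p y)
  have hσ : ContinuousOn σ W := S.s.continuous.comp_continuousOn
    ((continuousOn_extChartAt p).mono (hWV.trans (inter_subset_left.trans hsource)))
  have hσp : ContinuousAt σ p := S.s.continuous.continuousAt.comp (continuousAt_extChartAt p)
  obtain ⟨T, hT⟩ := ((hφ.tendsto_comp_of_mem_stable hf.continuous hx).eventually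
    (gt_mem_nhds (lt_add_of_pos_right _ hδ))).exists
  have hxT := htrap _ ((hφ.apply_mem_stable_iff T).2 hx) hT
  have hne : σ (φ T x) ≠ σ p := fun h => hφ.not_isCriticalPoint_apply hxc T <| by
    rwa [hWinj hxT (fun t _ => by
      rw [hφ.apply_of_isCriticalPoint hp]; exact mem_of_mem_nhds hW) h]
  have hσT : ContinuousAt (fun y => σ (φ T y)) x := S.s.continuous.continuousAt.comp <|
    (continuousAt_extChartAt' (hsource (hWV (trappedSet_subset φ W hxT)).1)).comp
      (φ.continuous continuous_const continuous_id).continuousAt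
  filter_upwards [((hσT.sub_const (σ p)).const_mul (σ (φ T x) - σ p)).eventually
      (lt_mem_nhds (mul_self_pos.2 (sub_ne_zero.2 hne))),
    (hf.continuous.comp (φ.continuous continuous_const continuous_id)).continuousAt.eventually
      (gt_mem_nhds hT)] with y hsign hyT hy
  have hyTp := (hφ.apply_mem_stable_iff T).2 hy
  obtain ⟨t, ht⟩ := exists_apply_eq_of_injOn_trappedSet φ hσ hWinj hσp hxT (htrap _ hyTp hyT)
    (hφ.mem_stable_iff.1 ((hφ.apply_mem_stable_iff T).2 hx)) (hφ.mem_stable_iff.1 hyTp) hsign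
  exact φ.mem_orbit_iff.2 ⟨-T + (t + T), by
    rw [φ.map_add, φ.map_add t, ht, ← φ.map_add, neg_add_cancel, φ.map_zero_apply]⟩

theorem hasDerivAt_chart_self (x : M) :
    HasDerivAt (fun t => extChartAt (𝓡 n) x (φ t x)) (-grad g f x) 0 := by
  refine (hφ.hasDerivAt_chart (x := x) (y := x) (t := 0) (by simp)).congr_deriv ?_
  rw [φ.map_zero_apply]
  exact (chartRep_extChartAt _ (mem_extChartAt_source x)).trans
    (tangentCoordChange_self (mem_extChartAt_source x))

theorem tangentOf_stable_le [T2Space M] [CompactSpace M] (hf : ContMDiff (𝓡 n) 𝓘(ℝ, ℝ) ∞ f)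
    {p x : M} (hp : IsCriticalPoint (n := n) f p) (hd : (hessian (n := n) f p).det ≠ 0)
    (S : SaddleFrame (linearization g f p)) (hx : x ∈ stable g f p)
    (hxc : ¬ IsCriticalPoint (n := n) f x) :
    tangentOf (stable g f p) x ≤ Submodule.span ℝ {grad g f x} := by
  refine Submodule.span_le.2 ?_
  rintro v ⟨γ, rfl, hγS, hγ⟩
  obtain ⟨hγc, hγd⟩ := hasMFDerivAt_curve_iff.1 hγ
  have horbit : ∀ᶠ t in 𝓝 0, ∃ τ, φ τ (γ 0) = γ t := by
    filter_upwards [hγc.eventually (hφ.eventually_mem_orbit hf hp hd S hx hxc), hγS] with t ht htS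
    exact φ.mem_orbit_iff.1 (ht htS)
  obtain ⟨τ, hτ⟩ := horbit.choice
  have hanti := hφ.strictAnti (hf.mdifferentiable (by simp)) hxc
  have hτ0 : τ 0 = 0 := hanti.injective (by simp [hτ.self_of_nhds])
  have hτc : ContinuousAt τ 0 := tendsto_of_strictAnti_comp hanti <| by
    refine Tendsto.congr' (f₁ := f ∘ γ) (hτ.mono fun t ht => congrArg f ht.symm) ?_
    rw [hτ.self_of_nhds]
    exact hf.continuous.continuousAt.comp hγc
  have hspan : v ∈ Submodule.span ℝ {-grad g f (γ 0)} :=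
    mem_span_singleton_of_hasDerivAt_comp (E := EuclideanSpace ℝ (Fin n))
      (hφ.hasDerivAt_chart_self (γ 0))
      (neg_ne_zero.2 fun h => hxc ((grad_eq_zero_iff g f (γ 0)).1 h)) hτc hτ0
      (hγd.congr_of_eventuallyEq (hτ.mono fun t ht => congrArg (extChartAt (𝓡 n) (γ 0)) ht))
  rwa [← Set.neg_singleton, Submodule.span_neg] at hspan

end IsGradFlow

section Shooting

variable {X : Type*} [TopologicalSpace X]

/-- The points whose forward orbit reaches `D` without having left `V`. -/
def reachSet (φ : Flow ℝ X) (V D : Set X) : Set X :=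
  {y | ∃ T, 0 ≤ T ∧ (∀ t ∈ Icc 0 T, φ t y ∈ V) ∧ φ T y ∈ D}

theorem subset_reachSet (φ : Flow ℝ X) (V D : Set X) : V ∩ D ⊆ reachSet φ V D := fun y hy => by
  refine ⟨0, le_rfl, fun t ht => ?_, by simpa using hy.2⟩
  rw [Icc_self, mem_singleton_iff] at ht
  simpa [ht] using hy.1

theorem isOpen_reachSet (φ : Flow ℝ X) {V D : Set X} (hV : IsOpen V) (hD : IsOpen D) :
    IsOpen (reachSet φ V D) := by
  refine isOpen_iff_mem_nhds.2 fun y ⟨T, hT, hyV, hyD⟩ => ?_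
  have hstay : ∀ᶠ x in 𝓝 y, ∀ t ∈ Icc 0 T, φ t x ∈ V :=
    isCompact_Icc.eventually_forall_of_forall_eventually fun t ht =>
      (φ.continuous continuous_snd continuous_fst).continuousAt.eventually
        (hV.mem_nhds (hyV t ht))
  filter_upwards [hstay, (φ.continuous continuous_const continuous_id).continuousAt.eventually
    (hD.mem_nhds hyD)] with x hxV hxD
  exact ⟨T, hT, hxV, hxD⟩

/-- As long as an orbit of `φ` stays in `V`, it cannot pass from `0 < h` to `h < 0`. -/
def IsBarrier (φ : Flow ℝ X) (V : Set X) (h : X → ℝ) : Prop :=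
  ∀ ⦃y T⦄, 0 ≤ T → (∀ t ∈ Icc 0 T, φ t y ∈ V) → 0 < h y → 0 ≤ h (φ T y)

theorem isBarrier_of_deriv_pos {φ : Flow ℝ X} {V : Set X} {h h' : X → ℝ}
    (hder : ∀ y t, φ t y ∈ V → HasDerivAt (fun t => h (φ t y)) (h' (φ t y)) t)
    (hpos : ∀ y ∈ V, h y = 0 → 0 < h' y) : IsBarrier φ V h := fun y T hT hV h0 => by
  have hd : ∀ t ∈ Icc 0 T, HasDerivAt (fun t => -h (φ t y)) (-h' (φ t y)) t := fun t ht =>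
    (hder y t (hV t ht)).neg
  refine neg_nonpos.1 (image_le_of_deriv_right_lt_deriv_boundary' (B := 0) (B' := 0)
    (fun t ht => (hd t ht).continuousAt.continuousWithinAt)
    (fun t ht => (hd t (Ico_subset_Icc_self ht)).hasDerivWithinAt) (by simpa using h0.le)
    continuousOn_const (fun t _ => hasDerivWithinAt_const t _ 0) (fun t ht hzero => ?_)
    (right_mem_Icc.2 hT))
  exact neg_neg_of_pos (hpos _ (hV t (Ico_subset_Icc_self ht)) (neg_eq_zero.1 hzero))

theorem IsBarrier.disjoint_reachSet {φ : Flow ℝ X} {V : Set X} {h₁ h₂ : X → ℝ}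
    (hb₁ : IsBarrier φ V h₁) (hb₂ : IsBarrier φ V h₂) (hlt : ∀ y ∈ V, h₁ y + h₂ y < 0) :
    Disjoint (reachSet φ V {y | 0 < h₁ y}) (reachSet φ V {y | 0 < h₂ y}) := by
  have key : ∀ {h k : X → ℝ} {y : X} {T T' : ℝ}, IsBarrier φ V h → (∀ y ∈ V, h y + k y < 0) →
      0 ≤ T → T ≤ T' → (∀ t ∈ Icc 0 T', φ t y ∈ V) → 0 < h (φ T y) → ¬ 0 < k (φ T' y) := by
    intro h k y T T' hb hneg hT hTT hV hpos
    have hnonneg := hb (y := φ T y) (sub_nonneg.2 hTT) (fun t ht => by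
      rw [← φ.map_add]
      exact hV _ ⟨add_nonneg ht.1 hT, le_sub_iff_add_le.1 ht.2⟩) hpos
    rw [← φ.map_add, sub_add_cancel] at hnonneg
    linarith [hneg _ (hV T' ⟨hT.trans hTT, le_rfl⟩)]
  rw [disjoint_left]
  rintro y ⟨T, hT, hTV, hT₁⟩ ⟨T', hT', hTV', hT₂⟩
  rcases le_total T T' with h | h
  · exact key hb₁ hlt hT h hTV' hT₁ hT₂
  · exact key hb₂ (fun y hy => by rw [add_comm]; exact hlt y hy) hT' h hTV hT₂ hT₁

theorem exists_mem_notMem_reachSet (φ : Flow ℝ X) {V I : Set X} {h₁ h₂ : X → ℝ} (hV : IsOpen V)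
    (hI : IsPreconnected I) (hIV : I ⊆ V) (hc₁ : ContinuousOn h₁ V) (hc₂ : ContinuousOn h₂ V)
    (hb₁ : IsBarrier φ V h₁) (hb₂ : IsBarrier φ V h₂) (hlt : ∀ y ∈ V, h₁ y + h₂ y < 0)
    (hI₁ : ∃ y ∈ I, 0 < h₁ y) (hI₂ : ∃ y ∈ I, 0 < h₂ y) :
    ∃ y ∈ I, y ∉ reachSet φ V {y | 0 < h₁ y} ∧ y ∉ reachSet φ V {y | 0 < h₂ y} := by
  have hopen : ∀ {h : X → ℝ}, ContinuousOn h V → IsOpen (reachSet φ V {y | 0 < h y}) := by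
    intro h hc
    have heq : reachSet φ V {y | 0 < h y} = reachSet φ V (V ∩ h ⁻¹' Ioi 0) := by
      ext y
      exact exists_congr fun T => and_congr_right fun hT => and_congr_right fun hTV =>
        (and_iff_right (hTV T ⟨hT, le_rfl⟩)).symm
    rw [heq]
    exact isOpen_reachSet φ hV (hc.isOpen_inter_preimage hV isOpen_Ioi)
  have hmeet : ∀ {h : X → ℝ}, (∃ y ∈ I, 0 < h y) →
      (I ∩ reachSet φ V {y | 0 < h y}).Nonempty := fun ⟨y, hyI, hy⟩ =>
    ⟨y, hyI, subset_reachSet φ V _ ⟨hIV hyI, hy⟩⟩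
  by_contra! hcover
  obtain ⟨y, -, hy₁, hy₂⟩ := hI _ _ (hopen hc₁) (hopen hc₂)
    (fun y hy => or_iff_not_imp_left.2 (hcover y hy)) (hmeet hI₁) (hmeet hI₂)
  exact disjoint_left.1 (hb₁.disjoint_reachSet hb₂ hlt) hy₁ hy₂

theorem mem_trappedSet_of_forall_Icc_mem (φ : Flow ℝ X) {V K : Set X} {y : X} (hV : IsOpen V)
    (hK : IsClosed K) (hy : y ∈ V)
    (hVK : ∀ T, 0 ≤ T → (∀ t ∈ Icc 0 T, φ t y ∈ V) → φ T y ∈ K)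
    (hKV : ∀ t, φ t y ∈ K → φ t y ∈ V) : y ∈ trappedSet φ K := by
  intro T hT
  have hcont : Continuous fun t => φ t y := φ.continuous continuous_id continuous_const
  have hinit : φ 0 y ∈ K := hVK 0 le_rfl fun t ht => by
    rwa [le_antisymm ht.2 ht.1, φ.map_zero_apply]
  refine ((hK.preimage hcont).inter isClosed_Icc).Icc_subset_of_forall_mem_nhdsGT_of_Icc_subset
    hinit (fun t ht hstay => ?_) (right_mem_Icc.2 hT)
  obtain ⟨r, htr, hr⟩ := mem_nhdsGE_iff_exists_Icc_subset.1
    (mem_nhdsWithin_of_mem_nhds ((hV.preimage hcont).mem_nhds (hKV t (hstay ⟨ht.1, le_rfl⟩))))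
  filter_upwards [Ioc_mem_nhdsGT htr] with T' hT'
  refine hVK T' (ht.1.trans hT'.1.le) fun t' ht' => ?_
  rcases le_total t' t with h | h
  · exact hKV t' (hstay ⟨ht'.1, h⟩)
  · exact hr ⟨h, ht'.2.trans hT'.2⟩

end Shooting

section Cone

theorem neg_of_abs_add_mul_le {a b p lam η ε : ℝ} (ha : 0 < a) (hb : |b| < 2 * ε * a)
    (hε : ε ≤ 1) (hlam : 0 < lam) (hη : 4 * η ≤ lam)
    (hp : |p + lam * a| ≤ η * (|a| + |b|)) : p < 0 := by
  rw [abs_of_pos ha] at hp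
  have hsum : a + |b| < 3 * a := by nlinarith
  have hbound : η * (a + |b|) ≤ 3 / 4 * lam * a := by
    nlinarith [mul_le_mul_of_nonneg_right hη (by positivity : 0 ≤ a + |b|)]
  nlinarith [le_abs_self (p + lam * a), mul_pos hlam ha]

theorem sub_mul_pos_of_abs_le {a b p q lam mu η ε : ℝ} (ha : 0 < a) (hb : b = ε * a) (hε₀ : 0 < ε)
    (hε : ε ≤ 1) (hlam : 0 < lam) (hη₀ : 0 ≤ η) (hη : 4 * η ≤ ε * mu)
    (hp : |p + lam * a| ≤ η * (|a| + |b|)) (hq : |q - mu * b| ≤ η * (|a| + |b|)) :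
    0 < q - ε * p := by
  have hb₀ : 0 < b := hb ▸ mul_pos hε₀ ha
  rw [abs_of_pos ha, abs_of_pos hb₀] at hp hq
  have hba : b ≤ a := by nlinarith
  have hbound : η * (a + b) ≤ η * (2 * a) := by gcongr; linarith
  have hp' : ε * p ≤ ε * (η * (2 * a) - lam * a) := by
    gcongr
    linarith [le_abs_self (p + lam * a)]
  have hlower : mu * b - η * (2 * a) ≤ q := by linarith [neg_abs_le (q - mu * b)]
  have hηa : ε * (η * (2 * a)) ≤ η * (2 * a) := mul_le_of_le_one_left (by positivity) hε
  have hmu : η * (4 * a) ≤ mu * b := by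
    rw [hb]
    nlinarith
  nlinarith [mul_pos hε₀ (mul_pos hlam ha)]

/-- The truncated closed cone of half-opening `ε` about the positive first axis. -/
def cone (ε ρ : ℝ) : Set (ℝ × ℝ) :=
  {z | 0 ≤ z.1 ∧ z.1 ≤ ρ ∧ |z.2| ≤ ε * z.1}

/-- On `T` the plane vector field `X` is `η`-close to the saddle `(a, b) ↦ (-lam a, mu b)`. -/
def IsNearlySaddle (lam mu η : ℝ) (X : ℝ × ℝ → ℝ × ℝ) (T : Set (ℝ × ℝ)) : Prop :=
  ∀ z ∈ T, |(X z).1 + lam * z.1| ≤ η * (|z.1| + |z.2|) ∧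
    |(X z).2 - mu * z.2| ≤ η * (|z.1| + |z.2|)

theorem cone_subset_cone_two_mul {ε : ℝ} (hε : 0 ≤ ε) (ρ : ℝ) : cone ε ρ ⊆ cone (2 * ε) ρ :=
  fun _ ⟨h₀, hρ, hu⟩ => ⟨h₀, hρ, hu.trans (by linarith [mul_nonneg hε h₀])⟩

theorem isCompact_cone (ε ρ : ℝ) : IsCompact (cone ε ρ) := by
  refine (isCompact_Icc.prod isCompact_Icc : IsCompact (Icc (0 : ℝ) ρ ×ˢ Icc (-(|ε| * ρ))
    (|ε| * ρ))).of_isClosed_subset ?_ fun z ⟨h₀, hρ, hz⟩ => ⟨⟨h₀, hρ⟩, abs_le.1 (hz.trans ?_)⟩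
  · exact (isClosed_le continuous_const continuous_fst).inter
      ((isClosed_le continuous_fst continuous_const).inter
        (isClosed_le continuous_snd.abs (continuous_const.mul continuous_fst)))
  · exact mul_le_mul (le_abs_self ε) hρ h₀ (abs_nonneg ε)

end Cone

section ConeShooting

variable {X : Type*} [TopologicalSpace X] {φ : Flow ℝ X} {ψ : OpenPartialHomeomorph X (ℝ × ℝ)}
  {F : ℝ × ℝ → ℝ × ℝ} {lam mu η ε ρ : ℝ}

/-- The part of the domain of the chart `ψ` lying over the open cone of half-opening `2 ε`. -/
def coneDomain (ψ : OpenPartialHomeomorph X (ℝ × ℝ)) (ε : ℝ) : Set X :=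
  ψ.source ∩ ψ ⁻¹' {z | 0 < z.1 ∧ |z.2| < 2 * ε * z.1}

theorem isOpen_coneDomain (ψ : OpenPartialHomeomorph X (ℝ × ℝ)) (ε : ℝ) :
    IsOpen (coneDomain ψ ε) :=
  ψ.isOpen_inter_preimage ((isOpen_lt continuous_const continuous_fst).inter
    (isOpen_lt continuous_snd.abs (continuous_const.mul continuous_fst)))

theorem symm_mem_coneDomain {z : ℝ × ℝ} (hz : z ∈ ψ.target) (hz₁ : 0 < z.1)
    (hz₂ : |z.2| < 2 * ε * z.1) : ψ.symm z ∈ coneDomain ψ ε :=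
  ⟨ψ.map_target hz, by rw [mem_preimage, ψ.right_inv hz]; exact ⟨hz₁, hz₂⟩⟩

theorem fst_le_of_forall_mem_coneDomain
    (hder : ∀ y t, φ t y ∈ ψ.source → HasDerivAt (fun t => ψ (φ t y)) (F (ψ (φ t y))) t)
    (hF : IsNearlySaddle lam mu η F ψ.target) (hε : ε ≤ 1) (hlam : 0 < lam) (hη : 4 * η ≤ lam)
    {y : X} {T : ℝ} (hT : 0 ≤ T) (hV : ∀ t ∈ Icc 0 T, φ t y ∈ coneDomain ψ ε) :
    (ψ (φ T y)).1 ≤ (ψ y).1 := by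
  have hd : ∀ t ∈ Icc 0 T, HasDerivAt (fun t => (ψ (φ t y)).1) (F (ψ (φ t y))).1 t :=
    fun t ht => (hder y t (hV t ht).1).fst
  have hanti : AntitoneOn (fun t => (ψ (φ t y)).1) (Icc 0 T) :=
    antitoneOn_of_hasDerivWithinAt_nonpos (convex_Icc 0 T)
      (fun t ht => (hd t ht).continuousAt.continuousWithinAt)
      (fun t ht => (hd t (interior_subset ht)).hasDerivWithinAt) fun t ht =>
        have hVt := hV t (interior_subset ht)
        (neg_of_abs_add_mul_le hVt.2.1 hVt.2.2 hε hlam hη (hF _ (ψ.map_source hVt.1)).1).le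
  simpa using hanti ⟨le_rfl, hT⟩ ⟨hT, le_rfl⟩ hT

theorem isBarrier_coneDomain
    (hder : ∀ y t, φ t y ∈ ψ.source → HasDerivAt (fun t => ψ (φ t y)) (F (ψ (φ t y))) t)
    (hF : IsNearlySaddle lam mu η F ψ.target) (hε₀ : 0 < ε) (hε : ε ≤ 1) (hlam : 0 < lam)
    (hη₀ : 0 ≤ η) (hη : 4 * η ≤ ε * mu) {σ : ℝ} (hσ : |σ| = 1) :
    IsBarrier φ (coneDomain ψ ε) fun y => σ * (ψ y).2 - ε * (ψ y).1 := by
  refine isBarrier_of_deriv_pos (h' := fun y => σ * (F (ψ y)).2 - ε * (F (ψ y)).1)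
    (fun y t hy => ?_) fun y hy hzero => ?_
  · have hfst : HasDerivAt (fun t => (ψ (φ t y)).1) (F (ψ (φ t y))).1 t := (hder y t hy.1).fst
    have hsnd : HasDerivAt (fun t => (ψ (φ t y)).2) (F (ψ (φ t y))).2 t := (hder y t hy.1).snd
    exact (hsnd.const_mul σ).sub (hfst.const_mul ε)
  obtain ⟨hs, hu⟩ := hF _ (ψ.map_source hy.1)
  have habs : ∀ r, |σ * r| = |r| := fun r => by rw [abs_mul, hσ, one_mul]
  refine sub_mul_pos_of_abs_le hy.2.1 (sub_eq_zero.1 hzero) hε₀ hε hlam hη₀ hη ?_ ?_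
  · rwa [habs]
  · rw [habs, mul_left_comm, ← mul_sub, habs]
    exact hu

theorem mem_trappedSet_cone_of_notMem_reachSet [T2Space X]
    (hder : ∀ y t, φ t y ∈ ψ.source → HasDerivAt (fun t => ψ (φ t y)) (F (ψ (φ t y))) t)
    (hF : IsNearlySaddle lam mu η F ψ.target) (hfix : ∀ t, φ t (ψ.symm 0) = ψ.symm 0)
    (hε₀ : 0 < ε) (hε : ε ≤ 1) (hlam : 0 < lam) (hη : 4 * η ≤ lam)
    (hcone : cone (2 * ε) ρ ⊆ ψ.target) {y : X} (hy : y ∈ coneDomain ψ ε) (hyρ : (ψ y).1 ≤ ρ)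
    (hyσ : ∀ σ : ℝ, |σ| = 1 →
      y ∉ reachSet φ (coneDomain ψ ε) {y | 0 < σ * (ψ y).2 - ε * (ψ y).1}) :
    y ∈ trappedSet φ (ψ.symm '' cone ε ρ) := by
  have hsub : cone ε ρ ⊆ ψ.target := (cone_subset_cone_two_mul hε₀.le ρ).trans hcone
  refine mem_trappedSet_of_forall_Icc_mem φ (isOpen_coneDomain ψ ε)
    ((isCompact_cone ε ρ).image_of_continuousOn (ψ.continuousOn_symm.mono hsub)).isClosed hy
    (fun T hT hV => ?_) ?_
  · obtain ⟨hsource, hpos, -⟩ := hV T ⟨hT, le_rfl⟩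
    have hnot : ∀ σ : ℝ, |σ| = 1 → σ * (ψ (φ T y)).2 ≤ ε * (ψ (φ T y)).1 := fun σ hσ =>
      not_lt.1 fun hlt => hyσ σ hσ ⟨T, hT, hV, sub_pos.2 hlt⟩
    refine ⟨ψ (φ T y), ⟨hpos.le, ?_, abs_le'.2 ⟨?_, ?_⟩⟩, ψ.left_inv hsource⟩
    · exact (fst_le_of_forall_mem_coneDomain hder hF hε hlam hη hT hV).trans hyρ
    · simpa using hnot 1 (by simp)
    · simpa using hnot (-1) (by simp)
  · rintro t ⟨z, hz, hzt⟩
    have hz₀ : z ≠ 0 := by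
      rintro rfl
      have hyz : y = ψ.symm 0 := by
        rw [← hfix (-t), hzt, ← φ.map_add, neg_add_cancel, φ.map_zero_apply]
      have hpos := hy.2.1
      rw [hyz, ψ.right_inv (hsub hz)] at hpos
      exact lt_irrefl _ hpos
    have hz₁ : 0 < z.1 := hz.1.lt_of_ne' fun h => hz₀ (Prod.ext h (abs_nonpos_iff.1 (by
      simpa [h] using hz.2.2)))
    rw [← hzt]
    exact symm_mem_coneDomain (hsub hz) hz₁ (hz.2.2.trans_lt (by linarith [mul_pos hε₀ hz₁]))

/-- Ważewski's argument: of the points on a vertical segment across the cone, some leave it through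
its upper side and others through its lower side, so one of them does neither. -/
theorem exists_forall_notMem_reachSet_cone
    (hder : ∀ y t, φ t y ∈ ψ.source → HasDerivAt (fun t => ψ (φ t y)) (F (ψ (φ t y))) t)
    (hF : IsNearlySaddle lam mu η F ψ.target) (hε₀ : 0 < ε) (hε : ε ≤ 1) (hlam : 0 < lam)
    (hη₀ : 0 ≤ η) (hη : 4 * η ≤ ε * mu) (hρ : 0 < ρ) (hcone : cone (2 * ε) ρ ⊆ ψ.target) :
    ∃ b, |b| < 2 * ε * ρ ∧ ∀ σ : ℝ, |σ| = 1 → ψ.symm (ρ, b) ∉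
      reachSet φ (coneDomain ψ ε) {y | 0 < σ * (ψ y).2 - ε * (ψ y).1} := by
  have hερ : 0 < ε * ρ := mul_pos hε₀ hρ
  set J : Set ℝ := Icc (-(3 / 2 * (ε * ρ))) (3 / 2 * (ε * ρ))
  have hJ : ∀ b ∈ J, |b| < 2 * ε * ρ := fun b hb => (abs_le.2 hb).trans_lt (by linarith)
  have hJT : ∀ b ∈ J, (ρ, b) ∈ ψ.target := fun b hb => hcone ⟨hρ.le, le_rfl, (hJ b hb).le⟩
  have hcont : ∀ σ : ℝ, ContinuousOn (fun y => σ * (ψ y).2 - ε * (ψ y).1) (coneDomain ψ ε) :=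
    fun σ => ((continuousOn_const.mul (continuous_snd.comp_continuousOn ψ.continuousOn)).sub
      (continuousOn_const.mul (continuous_fst.comp_continuousOn ψ.continuousOn))).mono
        inter_subset_left
  have hbar : ∀ σ : ℝ, |σ| = 1 → _ := fun σ =>
    isBarrier_coneDomain (σ := σ) hder hF hε₀ hε hlam hη₀ hη
  have hend : ∀ σ : ℝ, |σ| = 1 → ∃ y ∈ (fun b => ψ.symm (ρ, b)) '' J,
      0 < σ * (ψ y).2 - ε * (ψ y).1 := fun σ hσ => by
    have hσJ : σ * (3 / 2 * (ε * ρ)) ∈ J := abs_le.1 (by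
      rw [abs_mul, hσ, one_mul, abs_of_pos (by linarith)])
    refine ⟨_, mem_image_of_mem _ hσJ, ?_⟩
    rw [ψ.right_inv (hJT _ hσJ), ← mul_assoc, ← abs_mul_abs_self σ, hσ]
    linarith
  obtain ⟨_, ⟨b, hb, rfl⟩, hup, hdown⟩ := exists_mem_notMem_reachSet φ (isOpen_coneDomain ψ ε)
    (isPreconnected_Icc.image (fun b => ψ.symm (ρ, b)) (ψ.continuousOn_symm.comp
      (by fun_prop) hJT))
    (image_subset_iff.2 fun b hb => symm_mem_coneDomain (hJT b hb) hρ (hJ b hb))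
    (hcont 1) (hcont (-1)) (hbar 1 (by simp)) (hbar (-1) (by simp))
    (fun y hy => by linarith [mul_pos hε₀ hy.2.1]) (hend 1 (by simp)) (hend (-1) (by simp))
  exact ⟨b, hJ b hb, fun σ hσ => by rcases eq_or_eq_neg_of_abs_eq hσ with rfl | rfl <;> assumption⟩

theorem exists_mem_trappedSet_cone [T2Space X]
    (hder : ∀ y t, φ t y ∈ ψ.source → HasDerivAt (fun t => ψ (φ t y)) (F (ψ (φ t y))) t)
    (hF : IsNearlySaddle lam mu η F ψ.target) (hfix : ∀ t, φ t (ψ.symm 0) = ψ.symm 0)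
    (hε₀ : 0 < ε) (hε : ε ≤ 1) (hlam : 0 < lam) (hη₀ : 0 ≤ η) (hηs : 4 * η ≤ lam)
    (hηu : 4 * η ≤ ε * mu) (hρ : 0 < ρ) (hcone : cone (2 * ε) ρ ⊆ ψ.target) :
    ∃ b, |b| ≤ 2 * ε * ρ ∧ ψ.symm (ρ, b) ∈ trappedSet φ (ψ.symm '' cone ε ρ) := by
  obtain ⟨b, hb, hbσ⟩ := exists_forall_notMem_reachSet_cone hder hF hε₀ hε hlam hη₀ hηu hρ hcone
  have hbT : (ρ, b) ∈ ψ.target := hcone ⟨hρ.le, le_rfl, hb.le⟩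
  exact ⟨b, hb.le, mem_trappedSet_cone_of_notMem_reachSet hder hF hfix hε₀ hε hlam hηs hcone
    (symm_mem_coneDomain hbT hρ hb) (by rw [ψ.right_inv hbT]) hbσ⟩

end ConeShooting

namespace SaddleFrame

variable {E : Type*} [NormedAddCommGroup E] [NormedSpace ℝ E] {A : E →L[ℝ] E}

/-- The linear coordinates `(s, u)` of a saddle frame. -/
def coordEquiv (S : SaddleFrame A) : E ≃L[ℝ] ℝ × ℝ :=
  ContinuousLinearEquiv.equivOfInverse (S.s.prod S.u)
    ((ContinuousLinearMap.fst ℝ ℝ ℝ).smulRight S.es +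
      (ContinuousLinearMap.snd ℝ ℝ ℝ).smulRight S.eu)
    S.decomp fun z => by simp [S.s_es, S.s_eu, S.u_es, S.u_eu]

theorem coordEquiv_symm_apply (S : SaddleFrame A) (z : ℝ × ℝ) :
    S.coordEquiv.symm z = z.1 • S.es + z.2 • S.eu :=
  rfl

/-- The vector field `X` read in the coordinates of the frame `S` centred at `z₀`. -/
def coordField (S : SaddleFrame A) (X : E → E) (z₀ : E) (z : ℝ × ℝ) : ℝ × ℝ :=
  S.coordEquiv (X (z₀ + S.coordEquiv.symm z))

theorem IsCloseOn.isNearlySaddle_coordField {S : SaddleFrame A} {X : E → E} {z₀ : E} {η : ℝ}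
    {U : Set E} (hU : S.IsCloseOn X η U) (hz₀ : z₀ ∈ U) (hX : X z₀ = 0) {T : Set (ℝ × ℝ)}
    (hT : ∀ z ∈ T, z₀ + S.coordEquiv.symm z ∈ U) :
    IsNearlySaddle S.lam S.mu η (S.coordField X z₀) T := fun z hz => by
  have h := hU _ (hT z hz) z₀ hz₀
  have hs : S.s (S.coordEquiv.symm z) = z.1 := congrArg Prod.fst (S.coordEquiv.apply_symm_apply z)
  have hu : S.u (S.coordEquiv.symm z) = z.2 := congrArg Prod.snd (S.coordEquiv.apply_symm_apply z)
  rw [hX, sub_zero, add_sub_cancel_left, hs, hu] at h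
  exact h

end SaddleFrame

section StableCurve

variable {n : ℕ} {M : Type*} [TopologicalSpace M] [ChartedSpace (EuclideanSpace ℝ (Fin n)) M]

/-- The chart of `M` at `p` in which `p` is the origin and the axes are those of the frame `S`. -/
def saddleChart (p : M) {A : EuclideanSpace ℝ (Fin n) →L[ℝ] EuclideanSpace ℝ (Fin n)}
    (S : SaddleFrame A) : OpenPartialHomeomorph M (ℝ × ℝ) :=
  (chartAt (EuclideanSpace ℝ (Fin n)) p).transHomeomorph
    ((Homeomorph.subRight (extChartAt (𝓡 n) p p)).trans S.coordEquiv.toHomeomorph)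

variable {p : M} {A : EuclideanSpace ℝ (Fin n) →L[ℝ] EuclideanSpace ℝ (Fin n)}
  (S : SaddleFrame A)

theorem saddleChart_source : (saddleChart p S).source = (extChartAt (𝓡 n) p).source :=
  (extChartAt_source (𝓡 n) p).symm

theorem saddleChart_apply (y : M) : saddleChart p S y =
    S.coordEquiv (extChartAt (𝓡 n) p y - extChartAt (𝓡 n) p p) :=
  rfl

theorem saddleChart_self : saddleChart p S p = 0 := by
  rw [saddleChart_apply, sub_self, map_zero]

theorem saddleChart_symm_apply (z : ℝ × ℝ) : (saddleChart p S).symm z =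
    (extChartAt (𝓡 n) p).symm (extChartAt (𝓡 n) p p + S.coordEquiv.symm z) := by
  rw [add_comm]
  rfl

theorem saddleChart_flip_symm (a b : ℝ) :
    (saddleChart p S.flip).symm (-a, b) = (saddleChart p S).symm (a, b) := by
  simp only [saddleChart_symm_apply, SaddleFrame.coordEquiv_symm_apply, SaddleFrame.flip,
    neg_smul_neg]

theorem extChartAt_eq_add_coordEquiv_symm (y : M) : extChartAt (𝓡 n) p y =
    extChartAt (𝓡 n) p p + S.coordEquiv.symm (saddleChart p S y) := by
  rw [saddleChart_apply, S.coordEquiv.symm_apply_apply, add_sub_cancel]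

variable [IsManifold (𝓡 n) ∞ M] {g : Metric n M} {f : M → ℝ} {φ : Flow ℝ M}

theorem IsGradFlow.hasDerivAt_saddleChart (hφ : IsGradFlow g f φ) {y : M} {t : ℝ}
    (h : φ t y ∈ (extChartAt (𝓡 n) p).source) :
    HasDerivAt (fun t => saddleChart p S (φ t y)) (S.coordField (chartField g f p)
      (extChartAt (𝓡 n) p p) (saddleChart p S (φ t y))) t := by
  rw [SaddleFrame.coordField, ← extChartAt_eq_add_coordEquiv_symm]
  exact S.coordEquiv.hasFDerivAt.comp_hasDerivAt t
    ((hφ.hasDerivAt_chart h).sub_const (extChartAt (𝓡 n) p p))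

theorem eventually_cone_subset {T : Set (ℝ × ℝ)} (hT : T ∈ 𝓝 0) (ε : ℝ) :
    ∀ᶠ ρ in 𝓝[>] (0 : ℝ), cone ε ρ ⊆ T := by
  obtain ⟨r, hr, hball⟩ := Metric.mem_nhds_iff.1 hT
  have hsmall : ∀ᶠ ρ in 𝓝[>] (0 : ℝ), ρ < r ∧ |ε| * ρ < r := by
    refine (Filter.Tendsto.eventually_lt_const hr tendsto_id).and
      (Filter.Tendsto.eventually_lt_const (v := 0) hr ?_) |>.filter_mono nhdsWithin_le_nhds
    exact (continuous_const_mul |ε|).tendsto' 0 0 (mul_zero _)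
  filter_upwards [hsmall] with ρ ⟨hρ, hερ⟩ z ⟨h₀, hz, hu⟩
  refine hball (mem_ball_zero_iff.2 (max_lt ?_ ?_))
  · rw [Real.norm_of_nonneg h₀]
    exact hz.trans_lt hρ
  · exact (hu.trans (mul_le_mul (le_abs_self ε) hz h₀ (abs_nonneg ε))).trans_lt hερ

theorem IsNearlySaddle.eq_zero_of_mem_cone {lam mu η ε ρ : ℝ} {F : ℝ × ℝ → ℝ × ℝ}
    {T : Set (ℝ × ℝ)} (hF : IsNearlySaddle lam mu η F T) (hε₀ : 0 < ε) (hε : ε ≤ 1)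
    (hlam : 0 < lam) (hη : 4 * η ≤ lam) {z : ℝ × ℝ} (hzT : z ∈ T) (hz : z ∈ cone ε ρ)
    (hFz : F z = 0) : z = 0 := by
  rcases hz.1.eq_or_lt with h | h
  · exact Prod.ext h.symm (abs_nonpos_iff.1 (by simpa [← h] using hz.2.2))
  · refine absurd (neg_of_abs_add_mul_le h (hz.2.2.trans_lt ?_) hε hlam hη (hF z hzT).1) ?_
    · linarith [mul_pos hε₀ h]
    · simp [hFz]

theorem coordField_saddleChart_eq_zero (g : Metric n M) {y : M}
    (hy : y ∈ (extChartAt (𝓡 n) p).source) (hc : IsCriticalPoint (n := n) f y) :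
    S.coordField (chartField g f p) (extChartAt (𝓡 n) p p) (saddleChart p S y) = 0 := by
  rw [SaddleFrame.coordField, ← extChartAt_eq_add_coordEquiv_symm,
    (chartField_eq_zero_iff g ((extChartAt (𝓡 n) p).map_source hy)).2, map_zero]
  rwa [(extChartAt (𝓡 n) p).left_inv hy]

theorem exists_isNearlySaddle_restr_saddleChart (g : Metric n M)
    (hf : ContMDiff (𝓡 n) 𝓘(ℝ, ℝ) ∞ f) (hp : IsCriticalPoint (n := n) f p)
    (S : SaddleFrame (linearization g f p)) {η : ℝ} (hη : 0 < η) :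
    ∃ s ∈ 𝓝 p, IsNearlySaddle S.lam S.mu η
      (S.coordField (chartField g f p) (extChartAt (𝓡 n) p p))
      ((saddleChart p S).restr s).target := by
  obtain ⟨U, hU, hclose⟩ := S.exists_isCloseOn (hasStrictFDerivAt_chartField g hf p) hη
  refine ⟨extChartAt (𝓡 n) p ⁻¹' U, continuousAt_extChartAt (I := 𝓡 n) p hU,
    hclose.isNearlySaddle_coordField (mem_of_mem_nhds hU) (chartField_extChartAt_self g hp)
      fun z hz => ?_⟩
  have hzU := interior_subset hz.2
  rwa [mem_preimage, extChartAt_eq_add_coordEquiv_symm S,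
    (saddleChart p S).right_inv hz.1] at hzU

theorem IsGradFlow.eventually_exists_mem_stable [T2Space M] [CompactSpace M]
    (hφ : IsGradFlow g f φ) (hf : ContMDiff (𝓡 n) 𝓘(ℝ, ℝ) ∞ f)
    (hp : IsCriticalPoint (n := n) f p) (S : SaddleFrame (linearization g f p)) {ε : ℝ}
    (hε₀ : 0 < ε) (hε : ε ≤ 1) :
    ∀ᶠ a in 𝓝[>] (0 : ℝ), ∃ b, |b| ≤ 2 * ε * a ∧
      (saddleChart p S).symm (a, b) ∈ stable g f p := by
  obtain ⟨η, hη₀, hη⟩ := exists_between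
    (lt_min (div_pos S.lam_pos four_pos) (div_pos (mul_pos hε₀ S.mu_pos) four_pos))
  obtain ⟨hηs, hηu⟩ : 4 * η ≤ S.lam ∧ 4 * η ≤ ε * S.mu := by
    constructor <;> linarith [lt_min_iff.1 hη]
  obtain ⟨s, hs, hF⟩ := exists_isNearlySaddle_restr_saddleChart g hf hp S hη₀
  set ψ := (saddleChart p S).restr s
  have hsource : ψ.source ⊆ (extChartAt (𝓡 n) p).source :=
    inter_subset_left.trans (saddleChart_source S).subset
  have hpψ : p ∈ ψ.source := ⟨(saddleChart_source S).ge (mem_extChartAt_source p),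
    mem_interior_iff_mem_nhds.2 hs⟩
  have hψp : ψ p = 0 := saddleChart_self S
  have hψ₀ : ψ.symm 0 = p := by rw [← hψp, ψ.left_inv hpψ]
  have htarget : ψ.target ∈ 𝓝 0 := ψ.open_target.mem_nhds (hψp ▸ ψ.map_source hpψ)
  filter_upwards [eventually_cone_subset htarget (2 * ε), self_mem_nhdsWithin] with a hcone ha
  have hsub : cone ε a ⊆ ψ.target := (cone_subset_cone_two_mul hε₀.le a).trans hcone
  obtain ⟨b, hb, htrap⟩ := exists_mem_trappedSet_cone (ψ := ψ)
    (fun y t hy => hφ.hasDerivAt_saddleChart S (hsource hy)) hF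
    (fun t => by rw [hψ₀, hφ.apply_of_isCriticalPoint hp]) hε₀ hε S.lam_pos hη₀.le hηs hηu ha hcone
  refine ⟨b, hb, hφ.mem_stable_of_mem_trappedSet (hf.mdifferentiable (by simp))
    ((isCompact_cone ε a).image_of_continuousOn (ψ.continuousOn_symm.mono hsub)).isClosed
    ?_ htrap⟩
  rintro _ ⟨z, hz, rfl⟩ hcrit
  rw [← hψ₀]
  refine congrArg ψ.symm (hF.eq_zero_of_mem_cone hε₀ hε S.lam_pos hηs (hsub hz) hz ?_)
  rw [← ψ.right_inv (hsub hz)]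
  exact coordField_saddleChart_eq_zero S g (hsource (ψ.map_target (hsub hz))) hcrit

end StableCurve

section Selection

theorem exists_mem_forall_abs_le_add {s : Set ℝ} (hs : s.Nonempty) {δ : ℝ} (hδ : 0 < δ) :
    ∃ u ∈ s, ∀ v ∈ s, |u| ≤ |v| + δ := by
  obtain ⟨_, ⟨u, hu, rfl⟩, hlt⟩ := exists_lt_of_csInf_lt (hs.image abs)
    (lt_add_of_pos_right (sInf (abs '' s)) hδ)
  have hbdd : BddBelow (abs '' s) := ⟨0, forall_mem_image.2 fun w _ => abs_nonneg w⟩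
  refine ⟨u, hu, fun v hv => hlt.le.trans ?_⟩
  gcongr
  exact csInf_le hbdd (mem_image_of_mem _ hv)

theorem exists_hasDerivAt_zero_selection {W : ℝ → ℝ → Prop} (h₀ : W 0 0)
    (h : ∀ ε > 0, ∀ᶠ t in 𝓝[≠] (0 : ℝ), ∃ u, |u| ≤ ε * |t| ∧ W t u) :
    ∃ U : ℝ → ℝ, U 0 = 0 ∧ HasDerivAt U 0 0 ∧ ∀ᶠ t in 𝓝 0, W t (U t) := by
  have hex : ∀ t, ∃ u, (t = 0 → u = 0) ∧
      (t ≠ 0 → (∃ v, W t v) → W t u ∧ ∀ v, W t v → |u| ≤ |v| + t ^ 2) := fun t => by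
    by_cases ht : t ≠ 0 ∧ ∃ v, W t v
    · obtain ⟨u, hu, hle⟩ := exists_mem_forall_abs_le_add ht.2 (sq_pos_of_ne_zero ht.1)
      exact ⟨u, fun h => absurd h ht.1, fun _ _ => ⟨hu, hle⟩⟩
    · exact ⟨0, fun _ => rfl, fun h₁ h₂ => absurd ⟨h₁, h₂⟩ ht⟩
  choose U hU₀ hU using hex
  have hzero : U 0 = 0 := hU₀ 0 rfl
  refine ⟨U, hzero, ?_, ?_⟩
  · refine hasDerivAt_iff_isLittleO.2 (Asymptotics.isLittleO_iff.2 fun c hc => ?_)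
    simp only [hzero, sub_zero, smul_zero, Real.norm_eq_abs]
    filter_upwards [eventually_nhdsWithin_iff.1 (h (c / 2) (half_pos hc)),
      Metric.ball_mem_nhds (0 : ℝ) (half_pos hc)] with t hv ht
    rcases eq_or_ne t 0 with rfl | hne
    · simp [hzero]
    · obtain ⟨v, hvt, hWv⟩ := hv hne
      have hsq : t ^ 2 ≤ c / 2 * |t| := by
        rw [mem_ball_zero_iff, Real.norm_eq_abs] at ht
        rw [← sq_abs, pow_two]
        gcongr
      linarith [(hU t hne ⟨v, hWv⟩).2 v hWv]
  · filter_upwards [eventually_nhdsWithin_iff.1 (h 1 one_pos)] with t hv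
    rcases eq_or_ne t 0 with rfl | hne
    · rwa [hzero]
    · obtain ⟨v, -, hWv⟩ := hv hne
      exact (hU t hne ⟨v, hWv⟩).1

end Selection

section TangentOf

variable {n : ℕ} {M : Type*} [TopologicalSpace M] [ChartedSpace (EuclideanSpace ℝ (Fin n)) M]
  {s : Set M} {x : M}

theorem mem_tangentOf_of_hasDerivAt {c : ℝ → EuclideanSpace ℝ (Fin n)}
    {v : EuclideanSpace ℝ (Fin n)} (hc₀ : c 0 = extChartAt (𝓡 n) x x) (hc : HasDerivAt c v 0)
    (hs : ∀ᶠ t in 𝓝 0, (extChartAt (𝓡 n) x).symm (c t) ∈ s) : v ∈ tangentOf (n := n) s x := by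
  have hγ₀ : ((extChartAt (𝓡 n) x).symm ∘ c) 0 = x := by
    rw [Function.comp_apply, hc₀, extChartAt_to_inv]
  refine Submodule.subset_span
    ⟨(extChartAt (𝓡 n) x).symm ∘ c, hγ₀, hs, hasMFDerivAt_curve_iff.2 ⟨?_, ?_⟩⟩
  · refine ContinuousAt.comp ?_ hc.continuousAt
    rw [hc₀]
    exact continuousAt_extChartAt_symm x
  · rw [hγ₀]
    refine hc.congr_of_eventuallyEq ?_
    filter_upwards [hc.continuousAt.eventually_mem
      (hc₀ ▸ extChartAt_target_mem_nhds (I := 𝓡 n) x)] with t ht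
    exact (extChartAt (𝓡 n) x).right_inv ht

theorem tangentOf_eq_top_of_mem_nhds (hs : s ∈ 𝓝 x) : tangentOf (n := n) s x = ⊤ := by
  refine eq_top_iff.2 fun (v : EuclideanSpace ℝ (Fin n)) _ => ?_
  have hd : HasDerivAt (fun t : ℝ => extChartAt (𝓡 n) x x + t • v) v 0 := by
    simpa using ((hasDerivAt_id (0 : ℝ)).smul_const v).const_add (extChartAt (𝓡 n) x x)
  have h₀ : extChartAt (𝓡 n) x x + (0 : ℝ) • v = extChartAt (𝓡 n) x x := by
    rw [zero_smul, add_zero]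
  refine mem_tangentOf_of_hasDerivAt h₀ hd (hd.continuousAt.eventually
    (p := fun z => (extChartAt (𝓡 n) x).symm z ∈ s) ?_)
  simp only [h₀]
  refine (continuousAt_extChartAt_symm (I := 𝓡 n) x).eventually_mem ?_
  rwa [extChartAt_to_inv]

end TangentOf

section StableTangent

variable {n : ℕ} {M : Type*} [TopologicalSpace M] [T2Space M] [CompactSpace M]
  [ChartedSpace (EuclideanSpace ℝ (Fin n)) M] [IsManifold (𝓡 n) ∞ M] {g : Metric n M} {f : M → ℝ}
  {φ : Flow ℝ M} {p : M}

theorem IsGradFlow.eventually_ne_exists_mem_stable (hφ : IsGradFlow g f φ)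
    (hf : ContMDiff (𝓡 n) 𝓘(ℝ, ℝ) ∞ f) (hp : IsCriticalPoint (n := n) f p)
    (S : SaddleFrame (linearization g f p)) {ε : ℝ} (hε₀ : 0 < ε) (hε : ε ≤ 1) :
    ∀ᶠ a in 𝓝[≠] (0 : ℝ), ∃ b, |b| ≤ 2 * ε * |a| ∧
      (saddleChart p S).symm (a, b) ∈ stable g f p := by
  rw [← Iio_union_Ioi, nhdsWithin_union, eventually_sup]
  constructor
  · have hneg : Tendsto Neg.neg (𝓝[<] (0 : ℝ)) (𝓝[>] 0) := by
      simpa using tendsto_neg_nhdsLT (a := (0 : ℝ))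
    filter_upwards [hneg.eventually (hφ.eventually_exists_mem_stable hf hp S.flip hε₀ hε),
      self_mem_nhdsWithin] with a ⟨b, hb, hmem⟩ ha
    rw [saddleChart_flip_symm] at hmem
    exact ⟨b, by rwa [abs_of_neg (mem_Iio.1 ha)], hmem⟩
  · filter_upwards [hφ.eventually_exists_mem_stable hf hp S hε₀ hε, self_mem_nhdsWithin]
      with a ⟨b, hb, hmem⟩ ha
    exact ⟨b, by rwa [abs_of_pos (mem_Ioi.1 ha)], hmem⟩

theorem IsGradFlow.es_mem_tangentOf_stable (hφ : IsGradFlow g f φ)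
    (hf : ContMDiff (𝓡 n) 𝓘(ℝ, ℝ) ∞ f) (hp : IsCriticalPoint (n := n) f p)
    (S : SaddleFrame (linearization g f p)) : S.es ∈ tangentOf (n := n) (stable g f p) p := by
  have hthin : ∀ ε > 0, ∀ᶠ a in 𝓝[≠] (0 : ℝ), ∃ b, |b| ≤ ε * |a| ∧
      (saddleChart p S).symm (a, b) ∈ stable g f p := fun ε hε => by
    filter_upwards [hφ.eventually_ne_exists_mem_stable hf hp S
      (lt_min one_pos (half_pos hε)) (min_le_left 1 (ε / 2))] with a ⟨b, hb, hmem⟩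
    refine ⟨b, hb.trans ?_, hmem⟩
    gcongr
    linarith [min_le_right 1 (ε / 2)]
  have hself : (saddleChart p S).symm (0, 0) = p := by
    rw [saddleChart_symm_apply, Prod.mk_zero_zero, map_zero, add_zero, extChartAt_to_inv]
  obtain ⟨U, hU₀, hU, hmem⟩ := exists_hasDerivAt_zero_selection
    (W := fun a b => (saddleChart p S).symm (a, b) ∈ stable g f p)
    (by rw [hself]; exact hφ.mem_stable_self hp) hthin
  refine mem_tangentOf_of_hasDerivAt (c := fun t => extChartAt (𝓡 n) p p + (t • S.es + U t • S.eu))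
    (by simp only [zero_smul, hU₀, add_zero]) ?_
    (hmem.mono fun t ht => by rwa [saddleChart_symm_apply] at ht)
  have hd := (((hasDerivAt_id (0 : ℝ)).smul_const S.es).add (hU.smul_const S.eu)).const_add
    (extChartAt (𝓡 n) p p)
  exact hd.congr_deriv (by rw [one_smul, zero_smul, add_zero])

end StableTangent

section Transversality

variable {n : ℕ} {M : Type*} [TopologicalSpace M] [ChartedSpace (EuclideanSpace ℝ (Fin n)) M]
  {f : M → ℝ} {p x : M}

theorem isLocalMin_or_isLocalMax_or_isSaddle (hp : IsCriticalPoint (n := n) f p) :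
    IsLocalMin f p ∨ IsLocalMax f p ∨ IsSaddle n f p := by
  by_cases h : IsLocalExtr f p
  · exact h.imp_right Or.inl
  · exact Or.inr (Or.inr ⟨hp, h⟩)

theorem IsSaddle.neg (hp : IsSaddle n f p) : IsSaddle n (-f) p :=
  ⟨isCriticalPoint_neg_iff.2 hp.1, fun h => hp.2 (by simpa using IsLocalExtr.neg h)⟩

variable [IsManifold (𝓡 n) ∞ M] [T2Space M] [CompactSpace M] {g : Metric n M}

theorem eq_of_mem_unstable (hf : ContMDiff (𝓡 n) 𝓘(ℝ, ℝ) ∞ f) (hx : x ∈ unstable g f p)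
    (hxc : IsCriticalPoint (n := n) f x) : x = p := by
  obtain ⟨φ, hφ⟩ := exists_isGradFlow g hf
  rw [← stable_neg] at hx
  exact hφ.reverse.eq_of_mem_stable hx (isCriticalPoint_neg_iff.2 hxc)

theorem lt_of_mem_unstable (hf : ContMDiff (𝓡 n) 𝓘(ℝ, ℝ) ∞ f) (hx : x ∈ unstable g f p)
    (hxc : ¬ IsCriticalPoint (n := n) f x) : f x < f p := by
  obtain ⟨φ, hφ⟩ := exists_isGradFlow g hf
  rw [← stable_neg] at hx
  exact neg_lt_neg_iff.1 <| hφ.reverse.lt_of_mem_stable (hf.neg.mdifferentiable (by simp)) hx <|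
    mt isCriticalPoint_neg_iff.1 hxc

theorem not_isLocalMax_of_mem_stable (hf : ContMDiff (𝓡 n) 𝓘(ℝ, ℝ) ∞ f) (hx : x ∈ stable g f p)
    (hxc : ¬ IsCriticalPoint (n := n) f x) : ¬ IsLocalMax f p := fun hp => by
  obtain ⟨φ, hφ⟩ := exists_isGradFlow g hf
  obtain ⟨t, ht⟩ := ((hφ.mem_stable_iff.1 hx).eventually hp).exists
  exact (hφ.lt_of_mem_stable (hf.mdifferentiable (by simp)) ((hφ.apply_mem_stable_iff t).2 hx)
    (hφ.not_isCriticalPoint_apply hxc t)).not_ge ht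

theorem not_isLocalMin_of_mem_unstable (hf : ContMDiff (𝓡 n) 𝓘(ℝ, ℝ) ∞ f)
    (hx : x ∈ unstable g f p) (hxc : ¬ IsCriticalPoint (n := n) f x) : ¬ IsLocalMin f p := by
  rw [← stable_neg] at hx
  exact fun hp => not_isLocalMax_of_mem_stable hf.neg hx (mt isCriticalPoint_neg_iff.1 hxc) hp.neg

theorem tangentOf_stable_eq_top (hf : ContMDiff (𝓡 n) 𝓘(ℝ, ℝ) ∞ f) (hp : IsLocalMin f p)
    (hd : (hessian (n := n) f p).det ≠ 0) (hx : x ∈ stable g f p) :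
    tangentOf (n := n) (stable g f p) x = ⊤ := by
  obtain ⟨φ, hφ⟩ := exists_isGradFlow g hf
  exact tangentOf_eq_top_of_mem_nhds (hφ.stable_mem_nhds hf hp hd hx)

theorem tangentOf_unstable_eq_top (hf : ContMDiff (𝓡 n) 𝓘(ℝ, ℝ) ∞ f) (hp : IsLocalMax f p)
    (hd : (hessian (n := n) f p).det ≠ 0) (hx : x ∈ unstable g f p) :
    tangentOf (n := n) (unstable g f p) x = ⊤ := by
  rw [← stable_neg] at hx ⊢
  exact tangentOf_stable_eq_top hf.neg hp.neg (det_hessian_neg_ne_zero hd) hx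

end Transversality

section Surface

variable {M : Type*} [TopologicalSpace M] [T2Space M] [CompactSpace M]
  [ChartedSpace (EuclideanSpace ℝ (Fin 2)) M] [IsManifold (𝓡 2) ∞ M] {g : Metric 2 M} {f : M → ℝ}
  {p q x : M}

theorem IsSaddle.tangentOf_stable_le (hf : ContMDiff (𝓡 2) 𝓘(ℝ, ℝ) ∞ f) (hp : IsSaddle 2 f p)
    (hd : (hessian (n := 2) f p).det ≠ 0) (hx : x ∈ stable g f p)
    (hxc : ¬ IsCriticalPoint (n := 2) f x) :
    tangentOf (stable g f p) x ≤ Submodule.span ℝ {grad g f x} := by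
  obtain ⟨φ, hφ⟩ := exists_isGradFlow g hf
  obtain ⟨S⟩ := hp.nonempty_saddleFrame g hf hd
  exact hφ.tangentOf_stable_le hf hp.1 hd S hx hxc

theorem IsSaddle.tangentOf_unstable_le (hf : ContMDiff (𝓡 2) 𝓘(ℝ, ℝ) ∞ f) (hp : IsSaddle 2 f p)
    (hd : (hessian (n := 2) f p).det ≠ 0) (hx : x ∈ unstable g f p)
    (hxc : ¬ IsCriticalPoint (n := 2) f x) :
    tangentOf (unstable g f p) x ≤ Submodule.span ℝ {grad g f x} := by
  rw [← stable_neg] at hx ⊢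
  have hle : tangentOf (stable g (-f) p) x ≤ Submodule.span ℝ {grad g (-f) x} :=
    hp.neg.tangentOf_stable_le hf.neg (det_hessian_neg_ne_zero hd) hx
      (mt isCriticalPoint_neg_iff.1 hxc)
  rwa [grad_neg, ← Set.neg_singleton, Submodule.span_neg] at hle

theorem IsSaddle.tangentOf_sup_eq_top (hf : ContMDiff (𝓡 2) 𝓘(ℝ, ℝ) ∞ f) (hp : IsSaddle 2 f p)
    (hd : (hessian (n := 2) f p).det ≠ 0) :
    tangentOf (n := 2) (stable g f p) p ⊔ tangentOf (n := 2) (unstable g f p) p = ⊤ := by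
  obtain ⟨φ, hφ⟩ := exists_isGradFlow g hf
  obtain ⟨S⟩ := hp.nonempty_saddleFrame g hf hd
  have hs : S.es ∈ tangentOf (n := 2) (stable g f p) p := hφ.es_mem_tangentOf_stable hf hp.1 S
  have hu : S.eu ∈ tangentOf (n := 2) (unstable g f p) p := by
    rw [← stable_neg]
    obtain ⟨S', hS'⟩ : ∃ S' : SaddleFrame (linearization g (-f) p), S'.es = S.eu := by
      rw [linearization_neg]
      exact ⟨S.neg, rfl⟩
    rw [← hS']
    exact hφ.reverse.es_mem_tangentOf_stable hf.neg hp.neg.1 S'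
  refine eq_top_iff.2 fun v _ => ?_
  rw [← S.decomp v]
  exact Submodule.add_mem_sup (Submodule.smul_mem _ _ hs) (Submodule.smul_mem _ _ hu)

theorem tangentOf_sup_eq_top_of_isCriticalPoint (hf : ContMDiff (𝓡 2) 𝓘(ℝ, ℝ) ∞ f)
    (hp : IsCriticalPoint (n := 2) f p) (hd : (hessian (n := 2) f p).det ≠ 0) :
    tangentOf (n := 2) (stable g f p) p ⊔ tangentOf (n := 2) (unstable g f p) p = ⊤ := by
  obtain ⟨φ, hφ⟩ := exists_isGradFlow g hf
  rcases isLocalMin_or_isLocalMax_or_isSaddle hp with hmin | hmax | hsaddle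
  · rw [tangentOf_stable_eq_top hf hmin hd (hφ.mem_stable_self hp), top_sup_eq]
  · rw [tangentOf_unstable_eq_top hf hmax hd (hφ.mem_unstable_self hp), sup_top_eq]
  · exact hsaddle.tangentOf_sup_eq_top hf hd

theorem isSaddle_of_tangentOf_sup_ne_top (hf : IsMorse 2 f) (hp : IsCriticalPoint (n := 2) f p)
    (hq : IsCriticalPoint (n := 2) f q) (hxs : x ∈ stable g f q) (hxu : x ∈ unstable g f p)
    (hxc : ¬ IsCriticalPoint (n := 2) f x)
    (h : tangentOf (n := 2) (stable g f q) x ⊔ tangentOf (n := 2) (unstable g f p) x ≠ ⊤) :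
    IsSaddle 2 f p ∧ IsSaddle 2 f q := by
  constructor
  · rcases isLocalMin_or_isLocalMax_or_isSaddle hp with hmin | hmax | hsaddle
    · exact absurd hmin (not_isLocalMin_of_mem_unstable hf.smooth hxu hxc)
    · rw [tangentOf_unstable_eq_top hf.smooth hmax (hf.nondegenerate p hp) hxu, sup_top_eq] at h
      exact absurd rfl h
    · exact hsaddle
  · rcases isLocalMin_or_isLocalMax_or_isSaddle hq with hmin | hmax | hsaddle
    · rw [tangentOf_stable_eq_top hf.smooth hmin (hf.nondegenerate q hq) hxs, top_sup_eq] at h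
      exact absurd rfl h
    · exact absurd hmax (not_isLocalMax_of_mem_stable hf.smooth hxs hxc)
    · exact hsaddle

theorem exists_isNeumannLine_connects (hf : ContMDiff (𝓡 2) 𝓘(ℝ, ℝ) ∞ f) (hq : IsSaddle 2 f q)
    (hxs : x ∈ stable g f q) (hxu : x ∈ unstable g f p) (hxc : ¬ IsCriticalPoint (n := 2) f x) :
    ∃ γ : ℝ → M, IsNeumannLine g f γ ∧ Connects γ p q := by
  obtain ⟨φ, hφ⟩ := exists_isGradFlow g hf
  have hne : ∀ t, φ t x ≠ q := fun t heq => hφ.not_isCriticalPoint_apply hxc t (heq ▸ hq.1)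
  exact ⟨fun t => φ t x, ⟨hφ.isFlowLine x, q, hq,
    Or.inl fun t => ⟨(hφ.apply_mem_stable_iff t).2 hxs, hne t⟩⟩,
    hφ.mem_unstable_iff.1 hxu, hφ.mem_stable_iff.1 hxs⟩

theorem isMorseSmale_of_not_exists_connects (hf : IsMorse 2 f)
    (h : ¬ ∃ (γ : ℝ → M) (p q : M), IsNeumannLine g f γ ∧ IsSaddle 2 f p ∧ IsSaddle 2 f q ∧
      p ≠ q ∧ Connects γ q p) : IsMorseSmale g f := by
  refine ⟨hf, fun p q hp hq x ⟨hxs, hxu⟩ => ?_⟩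
  obtain ⟨φ, hφ⟩ := exists_isGradFlow g hf.smooth
  by_cases hxc : IsCriticalPoint (n := 2) f x
  · obtain rfl := hφ.eq_of_mem_stable hxs hxc
    obtain rfl := eq_of_mem_unstable hf.smooth hxu hxc
    exact tangentOf_sup_eq_top_of_isCriticalPoint hf.smooth hxc (hf.nondegenerate x hxc)
  · by_contra hne
    obtain ⟨hps, hqs⟩ := isSaddle_of_tangentOf_sup_ne_top hf hp hq hxs hxu hxc hne
    obtain ⟨γ, hγ, hpq⟩ := exists_isNeumannLine_connects hf.smooth hqs hxs hxu hxc
    have hlt : f q < f p :=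
      (hφ.lt_of_mem_stable (hf.smooth.mdifferentiable (by simp)) hxs hxc).trans
        (lt_of_mem_unstable hf.smooth hxu hxc)
    exact h ⟨γ, q, p, hγ, hqs, hps, fun heq => hlt.ne (congrArg f heq), hpq⟩

theorem tangentOf_sup_ne_top_of_isSaddle (hf : IsMorse 2 f) (hp : IsSaddle 2 f p)
    (hq : IsSaddle 2 f q) (hxs : x ∈ stable g f q) (hxu : x ∈ unstable g f p)
    (hxc : ¬ IsCriticalPoint (n := 2) f x) :
    tangentOf (n := 2) (stable g f q) x ⊔ tangentOf (n := 2) (unstable g f p) x ≠ ⊤ := fun h => by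
  have hle : (⊤ : Submodule ℝ (TangentSpace (𝓡 2) x)) ≤ Submodule.span ℝ {grad g f x} := by
    rw [← h]
    exact sup_le (hq.tangentOf_stable_le hf.smooth (hf.nondegenerate q hq.1) hxs hxc)
      (hp.tangentOf_unstable_le hf.smooth (hf.nondegenerate p hp.1) hxu hxc)
  have hrank := (Submodule.finrank_mono hle).trans (finrank_span_singleton
    (mt (grad_eq_zero_iff g f x).1 hxc)).le
  have hdim : Module.finrank ℝ (TangentSpace (𝓡 2) x) = 2 :=
    finrank_euclideanSpace_fin (𝕜 := ℝ) (n := 2)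
  rw [finrank_top] at hrank
  lia

theorem IsMorseSmale.not_exists_connects (h : IsMorseSmale g f) :
    ¬ ∃ (γ : ℝ → M) (p q : M), IsNeumannLine g f γ ∧ IsSaddle 2 f p ∧ IsSaddle 2 f q ∧
      p ≠ q ∧ Connects γ q p := by
  rintro ⟨γ, p, q, ⟨hγ, -⟩, hp, hq, hne, hbot, htop⟩
  obtain ⟨hf, htrans⟩ := h
  obtain ⟨φ, hφ⟩ := exists_isGradFlow g hf.smooth
  have hxs : γ 0 ∈ stable g f p := ⟨γ, hγ, rfl, htop⟩
  have hxu : γ 0 ∈ unstable g f q := ⟨γ, hγ, rfl, hbot⟩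
  have hxc : ¬ IsCriticalPoint (n := 2) f (γ 0) := fun hc =>
    hne ((hφ.eq_of_mem_stable hxs hc).symm.trans (eq_of_mem_unstable hf.smooth hxu hc))
  exact tangentOf_sup_ne_top_of_isSaddle hf hq hp hxs hxu hxc
    (htrans q p hq.1 hp.1 (γ 0) ⟨hxs, hxu⟩)

end Surface

end GradientFlow

end

theorem mainTheorem8 {M : Type*} [TopologicalSpace M] [T2Space M] [CompactSpace M]
    [ChartedSpace (EuclideanSpace ℝ (Fin 2)) M] [IsManifold (𝓡 2) ∞ M]
    (g : GradientFlow.Metric 2 M) (f : M → ℝ) (hf : GradientFlow.IsMorse 2 f) :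
    GradientFlow.IsMorseSmale g f ↔
      ¬ ∃ (γ : ℝ → M) (p q : M), GradientFlow.IsNeumannLine g f γ ∧
        GradientFlow.IsSaddle 2 f p ∧ GradientFlow.IsSaddle 2 f q ∧ p ≠ q ∧
        GradientFlow.Connects γ q p :=
  ⟨fun h => h.not_exists_connects, GradientFlow.isMorseSmale_of_not_exists_connects hf⟩
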